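/- Let $P$ be a partially ordered set with underlying set $\{1,\dots,N\}$, $N\ge 1$, and order $\preceq$ (not necessarily compatible with the usual order of the integers), and let $\mathbf k$ be a field whose characteristic is $0$ or greater than $N$. Let $\mathfrak g=\mathfrak g(P)$ be the Lie poset algebra: the Lie algebra, under the commutator, of all $N\times N$ matrices over $\mathbf k$ of trace zero that are linear combinations of the matrix units $e_{ij}$ with $i\preceq j$. Let $\mathfrak h\subset\mathfrak g$ be the Abelian subalgebra of diagonal matrices of trace zero, $\mathfrak h^\vee$ its dual space, and $\mathfrak c$ the center of $\mathfrak g$. Let $\Sigma$ be the nerve of $P$, whose nondegenerate $q$-simplices are the chains $i_0\prec i_1\prec\cdots\prec i_q$, and let $\Sigma^+$ be $\Sigma$ augmented by a single simplex of dimension $-1$ that is the boundary of every $0$-simplex. Write $H^*(\Sigma,\mathbf k)$ and $H^*(\Sigma^+,\mathbf k)$ for simplicial cohomology, $H^*(\mathfrak g,\mathfrak g)$ for the Chevalley–Eilenberg cohomology of $\mathfrak g$ with coefficients in the adjoint module, and $H^*(\mathfrak h,\mathbf k)$ for that of $\mathfrak h$ with coefficients in the trivial module $\mathbf k$. Then,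 as graded $\mathbf k$-vector spaces, $$H^*(\mathfrak g,\mathfrak g)\;\cong\;\bigwedge\mathfrak h^\vee\otimes H^*(\Sigma^+,\mathbf k)\;=\;H^*(\mathfrak h,\mathbf k)\otimes H^*(\Sigma^+,\mathbf k).$$ That is, $H^{-1}(\Sigma^+,\mathbf k)=0$, and for every $n\ge 0$ $$H^n(\mathfrak g,\mathfrak g)\;\cong\;\bigoplus_{p+q=n}\bigwedge^p\mathfrak h^\vee\otimes H^q(\Sigma^+,\mathbf k)\;\cong\;\bigoplus_{p+q=n}H^p(\mathfrak h,\mathbf k)\otimes H^q(\Sigma^+,\mathbf k)\qquad(p,q\ge 0).$$ Here $\bigwedge^p\mathfrak h^\vee$ is identified with $H^p(\mathfrak h,\mathbf k)$ by the isomorphism that sends $\xi_1\wedge\cdots\wedge\xi_p$ to the class of the cocycle $(h_1,\dots,h_p)\mapsto\det(\xi_i(h_j))$. As a consequence, $$H^2(\mathfrak g,\mathfrak g)\;\cong\;\Bigl(\bigwedge^2\mathfrak h^\vee\otimes\mathfrak c\Bigr)\oplus\bigl(\mathfrak h^\vee\otimes H^1(\Sigma,\mathbf k)\bigr)\oplus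 H^2(\Sigma,\mathbf k).$$ -/

import Mathlib

open scoped TensorProduct DirectSum

/- Matrices carry the commutator bracket. -/
attribute [local instance 100] LieRing.ofAssociativeRing

namespace LiePoset

noncomputable section

/-! ### Chevalley–Eilenberg cohomology -/

section ChevalleyEilenberg

variable (k L M : Type*) [CommRing k] [LieRing L] [LieAlgebra k L]
  [AddCommGroup M] [Module k M] [LieRingModule L M] [LieModule k L M]

/-- The part `∑_{i<j} (-1)^{i+j} F([g_i, g_j], g_0, …, ĝ_i, …, ĝ_j, …, g_n)` of the
Chevalley–Eilenberg coboundary of an `n`-cochain `F` (an empty sum for `n = 0`).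
For `i : Fin (n + 1)` and `j : Fin (n + 2)` with `i < j`, the remaining arguments are obtained by
omitting first `j`, then `i`. -/
def ceBracketTerm : ∀ {n : ℕ}, (L [⋀^Fin n]→ₗ[k] M) → (Fin (n + 1) → L) → M
  | 0, _, _ => 0
  | n + 1, F, g =>
      ∑ j : Fin (n + 2), ∑ i : Fin (n + 1),
        if i.castSucc < j then
          (-1 : k) ^ ((i : ℕ) + (j : ℕ)) •
            F (Fin.cons ⁅g i.castSucc, g j⁆ fun l => g (j.succAbove (i.succAbove l)))
        else 0

/-- The Chevalley–Eilenberg coboundary `δF`, as a function of `n + 1` arguments, of an `n`-cochain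
`F : C^n(L, M)`, i.e. of an alternating `n`-linear map from `L` to `M`. -/
def ceDelta (n : ℕ) : (L [⋀^Fin n]→ₗ[k] M) →ₗ[k] ((Fin (n + 1) → L) → M) where
  toFun F g :=
    (∑ i : Fin (n + 1), (-1 : k) ^ (i : ℕ) • ⁅g i, F fun l => g (i.succAbove l)⁆)
      + ceBracketTerm k L M F g
  map_add' F G := by
    funext g
    cases n with
    | zero => simp [ceBracketTerm]
    | succ n =>
      simp only [ceBracketTerm, AlternatingMap.add_apply, lie_add, smul_add, Finset.sum_add_distrib,
        Pi.add_apply, ← Finset.sum_filter]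
      abel
  map_smul' c F := by
    funext g
    cases n with
    | zero => simp [ceBracketTerm]
    | succ n =>
      simp only [ceBracketTerm, AlternatingMap.smul_apply, lie_smul, smul_comm _ c,
        RingHom.id_apply, Pi.smul_apply, smul_add, Finset.smul_sum, ← Finset.sum_filter]

/-- The `n`-cocycles: the cochains `F` with `δF = 0`. -/
def ceCocycles (n : ℕ) : Submodule k (L [⋀^Fin n]→ₗ[k] M) :=
  LinearMap.ker (ceDelta k L M n)

/-- The `n`-coboundaries: the cochains of the form `δG` with `G` an `(n - 1)`-cochain. -/
def ceCoboundaries : ∀ n : ℕ, Submodule k (L [⋀^Fin n]→ₗ[k] M)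
  | 0 => ⊥
  | n + 1 =>
    { carrier := {F | ∃ G : L [⋀^Fin n]→ₗ[k] M, ∀ g : Fin (n + 1) → L, F g = ceDelta k L M n G g}
      add_mem' := by
        rintro _ _ ⟨G, hG⟩ ⟨G', hG'⟩
        exact ⟨G + G', fun g => by simp [hG, hG']⟩
      zero_mem' := ⟨0, fun g => by simp⟩
      smul_mem' := by
        rintro c _ ⟨G, hG⟩
        exact ⟨c • G, fun g => by simp [hG]⟩ }

/-- The Chevalley–Eilenberg cohomology `H^n(L, M)`: cocycles modulo coboundaries. -/
abbrev ceCohomology (n : ℕ) : Type _ :=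
  ceCocycles k L M n ⧸ (ceCoboundaries k L M n).submoduleOf (ceCocycles k L M n)

end ChevalleyEilenberg

/-! ### Simplicial cohomology of the nerve of a poset -/

section Nerve

variable (k P : Type*) [CommRing k] [PartialOrder P]

/-- The nondegenerate simplices of the nerve of `P` with `m` vertices (so of dimension `m - 1`):
the chains `c 0 < c 1 < ⋯ < c (m - 1)`. For `m = 0` there is exactly one, the empty
simplex, which has dimension `-1`. -/
def Chain (m : ℕ) : Type _ := {c : Fin m → P // StrictMono c}

variable {P} in
/-- The face of a simplex opposite to its `i`-th vertex. -/
def Chain.face {m : ℕ} (c : Chain P (m + 1)) (i : Fin (m + 1)) : Chain P m :=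
  ⟨fun l => c.1 (i.succAbove l), c.2.comp i.strictMono_succAbove⟩

/-- The simplicial coboundary, from functions on simplices with `m` vertices to functions on
simplices with `m + 1` vertices. For `m = 0` the unique `(-1)`-simplex is the boundary of
every `0`-simplex. -/
def nerveDelta (m : ℕ) : (Chain P m → k) →ₗ[k] (Chain P (m + 1) → k) where
  toFun f c := ∑ i : Fin (m + 1), (-1 : k) ^ (i : ℕ) * f (c.face i)
  map_add' f g := by
    funext c
    simp [mul_add, Finset.sum_add_distrib]
  map_smul' a f := by
    funext c
    simp [Finset.mul_sum, mul_left_comm]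

/-- The coboundaries of the nerve `Σ` in degree `q`. -/
def nerveCoboundaries : ∀ q : ℕ, Submodule k (Chain P (q + 1) → k)
  | 0 => ⊥
  | q + 1 => LinearMap.range (nerveDelta k P (q + 1))

/-- `H^q(Σ, k)`, the simplicial cohomology of the nerve `Σ` of `P`, for `q ≥ 0`. -/
abbrev nerveCohomology (q : ℕ) : Type _ :=
  LinearMap.ker (nerveDelta k P (q + 1)) ⧸
    (nerveCoboundaries k P q).submoduleOf (LinearMap.ker (nerveDelta k P (q + 1)))

/-- `H^q(Σ⁺, k)` for `q ≥ 0`, where `Σ⁺` is the nerve augmented by a single simplex of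
dimension `-1`. -/
abbrev augNerveCohomology (q : ℕ) : Type _ :=
  LinearMap.ker (nerveDelta k P (q + 1)) ⧸
    (LinearMap.range (nerveDelta k P q)).submoduleOf (LinearMap.ker (nerveDelta k P (q + 1)))

/-- `H^{-1}(Σ⁺, k)`: there are no cochains in degree `-2`, so this is just the space of cocycles
in degree `-1`. -/
abbrev augNerveCohomologyNegOne : Type _ := LinearMap.ker (nerveDelta k P 0)

end Nerve

/-! ### Lie poset algebras -/

section Algebra

variable (k P : Type*) [CommRing k] [Fintype P] [DecidableEq P]

/-- The Lie poset algebra `𝔤(P)`: the Lie algebra, under the commutator of matrices, of the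
combinations of trace zero of the matrix units `e_{ij}` with `i ≤ j` in `P`. -/
def lieAlg [PartialOrder P] : LieSubalgebra k (Matrix P P k) where
  carrier := {A | (∀ i j, ¬ i ≤ j → A i j = 0) ∧ A.trace = 0}
  add_mem' := by
    rintro A B ⟨hA, hA'⟩ ⟨hB, hB'⟩
    exact ⟨fun i j h => by simp [hA i j h, hB i j h], by simp [hA', hB']⟩
  zero_mem' := by simp
  smul_mem' := by
    rintro c A ⟨hA, hA'⟩
    exact ⟨fun i j h => by simp [hA i j h], by simp [hA']⟩
  lie_mem' := by
    rintro A B ⟨hA, -⟩ ⟨hB, -⟩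
    have key : ∀ {X Y : Matrix P P k}, (∀ i j, ¬ i ≤ j → X i j = 0) →
        (∀ i j, ¬ i ≤ j → Y i j = 0) → ∀ i j, ¬ i ≤ j → (X * Y) i j = 0 := by
      intro X Y hX hY i j h
      rw [Matrix.mul_apply]
      refine Finset.sum_eq_zero fun l _ => ?_
      by_cases h₁ : i ≤ l
      · rw [hY l j fun h₂ => h (h₁.trans h₂), mul_zero]
      · rw [hX i l h₁, zero_mul]
    refine ⟨fun i j h => ?_, ?_⟩
    · rw [Ring.lie_def, Matrix.sub_apply, key hA hB i j h, key hB hA i j h, sub_zero]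
    · rw [Ring.lie_def, Matrix.trace_sub, Matrix.trace_mul_comm, sub_self]

/-- The Cartan subalgebra `𝔥`: the diagonal matrices of trace zero. -/
def cartan : LieSubalgebra k (Matrix P P k) where
  carrier := {A | A.IsDiag ∧ A.trace = 0}
  add_mem' := by
    rintro A B ⟨hA, hA'⟩ ⟨hB, hB'⟩
    exact ⟨hA.add hB, by simp [hA', hB']⟩
  zero_mem' := by simp [Matrix.isDiag_zero]
  smul_mem' := by
    rintro c A ⟨hA, hA'⟩
    exact ⟨hA.smul c, by simp [hA']⟩
  lie_mem' := by
    rintro A B ⟨hA, -⟩ ⟨hB, -⟩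
    refine ⟨?_, ?_⟩
    · rw [Ring.lie_def, ← hA.diagonal_diag, ← hB.diagonal_diag, Matrix.diagonal_mul_diagonal,
        Matrix.diagonal_mul_diagonal]
      exact (Matrix.isDiag_diagonal _).sub (Matrix.isDiag_diagonal _)
    · rw [Ring.lie_def, Matrix.trace_sub, Matrix.trace_mul_comm, sub_self]

/-- `H^n(𝔤(P), 𝔤(P))`: Chevalley–Eilenberg cohomology with adjoint coefficients. -/
abbrev adjointCohomology [PartialOrder P] (n : ℕ) : Type _ :=
  ceCohomology k (lieAlg k P) (lieAlg k P) n

/-- `H^p(𝔥, k)`: Chevalley–Eilenberg cohomology of `𝔥` with coefficients in the trivial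
module `k`. -/
abbrev cartanCohomology (p : ℕ) : Type _ :=
  ceCohomology k (cartan k P) (TrivialLieModule k (cartan k P) k) p

/-- The exterior power `⋀^p 𝔥^∨` of the dual space of `𝔥`. -/
abbrev cartanDualPower (p : ℕ) : Type _ :=
  ⋀[k]^p (Module.Dual k (cartan k P))

end Algebra

end

end LiePoset

/-
The diagonal matrices form a torus acting semisimply on the Chevalley–Eilenberg complex of `𝔤`, and
they act by zero on cohomology, so the invariant cochains compute it. Each torus generator `x` has a
dual form `ξ` that vanishes on commutators; wedging with `ξ` splits the invariant complex into the
cochains killed by contraction with `x` and a shifted copy of them, so the Poincaré series acquires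
a factor `1 + X`. What is left is the complex of cochains relative to the torus. Regard a tuple of
matrix units `e_{ij}`, `i < j`, as a set of arrows in `P`. An invariant form vanishes on it unless
its weight matches that of its value, that is unless the arrows form a flow from one point to
another; the characteristic hypothesis turns the congruences into equalities, and a flow of distinct
arrows in a poset, read from a source, is a chain. Hence a relative cochain is a function on the
chains of `P`, and the relative complex is the cochain complex of the nerve, except in degree `0`,
where trace zero replaces the quotient by constants: this is the augmentation.
-/

namespace LiePoset

open Module PowerSeries Submodule

section LinearAlgebra

theorem finrank_map_add_finrank_inf_ker {k V W : Type*} [Field k] [AddCommGroup V] [Module k V]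
    [FiniteDimensional k V] [AddCommGroup W] [Module k W] (f : V →ₗ[k] W) (K : Submodule k V) :
    finrank k (K.map f) + finrank k ↥(K ⊓ LinearMap.ker f) = finrank k K := by
  have hker : LinearMap.ker (f.domRestrict K) = (LinearMap.ker f).submoduleOf K :=
    LinearMap.ker_comp K.subtype f
  have hequiv := (submoduleOfEquivOfLe (inf_le_left : K ⊓ LinearMap.ker f ≤ K)).finrank_eq
  rw [← (f.domRestrict K).finrank_range_add_finrank_ker, LinearMap.range_domRestrict, hker,
    ← hequiv, submoduleOf, submoduleOf, comap_inf, comap_subtype_self, top_inf_eq]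

theorem finrank_map_of_disjoint_ker {k V W : Type*} [Field k] [AddCommGroup V] [Module k V]
    [FiniteDimensional k V] [AddCommGroup W] [Module k W] {f : V →ₗ[k] W} {K : Submodule k V}
    (h : Disjoint K (LinearMap.ker f)) : finrank k (K.map f) = finrank k K := by
  rw [← finrank_map_add_finrank_inf_ker f K, h.eq_bot, finrank_bot, add_zero]

theorem finrank_quotient_submoduleOf {k V : Type*} [Field k] [AddCommGroup V] [Module k V]
    [FiniteDimensional k V] {B Z : Submodule k V} (h : B ≤ Z) :
    (finrank k (Z ⧸ B.submoduleOf Z) : ℤ) = finrank k Z - finrank k B := by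
  rw [← (submoduleOfEquivOfLe h).finrank_eq, ← (B.submoduleOf Z).finrank_quotient_add_finrank]
  push_cast
  ring

theorem map_map_eq_map_of_forall_mem {k V : Type*} [Field k] [AddCommGroup V] [Module k V]
    [FiniteDimensional k V] {f : Module.End k V} {K : Submodule k V} (h_mem : ∀ v ∈ K, f v ∈ K)
    (hf : ∀ v ∈ K, f (f v) = 0 → f v = 0) : (K.map f).map f = K.map f := by
  refine eq_of_le_of_finrank_eq (map_mono (map_le_iff_le_comap.2 h_mem)) ?_
  refine finrank_map_of_disjoint_ker (disjoint_def.2 ?_)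
  rintro _ ⟨v, hv, rfl⟩
  exact hf v hv

variable {k : Type*} [Field k] {V : ℕ → Type*} [∀ n, AddCommGroup (V n)] [∀ n, Module k (V n)]

/-- The Hilbert series `∑ dim (K n) X ^ n` of a graded subspace. -/
noncomputable def hilbertSeries (K : ∀ n, Submodule k (V n)) : ℤ⟦X⟧ :=
  .mk fun n => finrank k (K n)

/-- The Poincaré series of the cohomology of a subcomplex `K` of a cochain complex `(V, d)`.
It is encoded through the cocycles `Z n = K n ⊓ ker d` alone, the coboundaries in degree `n + 1`
having dimension `dim (K n) - dim (Z n)`. -/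
noncomputable def cohomologySeries (d : ∀ n, V n →ₗ[k] V (n + 1)) (K : ∀ n, Submodule k (V n)) :
    ℤ⟦X⟧ :=
  (1 + X) * hilbertSeries (fun n => K n ⊓ LinearMap.ker (d n)) - X * hilbertSeries K

theorem coeff_zero_cohomologySeries (d : ∀ n, V n →ₗ[k] V (n + 1)) (K : ∀ n, Submodule k (V n)) :
    coeff 0 (cohomologySeries d K) = finrank k ↥(K 0 ⊓ LinearMap.ker (d 0)) := by
  simp [cohomologySeries, hilbertSeries, add_mul]

variable [∀ n, FiniteDimensional k (V n)] {d : ∀ n, V n →ₗ[k] V (n + 1)}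
  {K : ∀ n, Submodule k (V n)}

variable (d K) in
theorem coeff_succ_cohomologySeries (n : ℕ) :
    coeff (n + 1) (cohomologySeries d K) =
      finrank k ↥(K (n + 1) ⊓ LinearMap.ker (d (n + 1))) - finrank k ((K n).map (d n)) := by
  have := finrank_map_add_finrank_inf_ker (d n) (K n)
  simp only [cohomologySeries, hilbertSeries, add_mul, one_mul, map_sub, map_add, coeff_mk,
    coeff_succ_X_mul]
  lia

theorem cohomologySeries_eq_zero (h_zero : K 0 ⊓ LinearMap.ker (d 0) = ⊥)
    (h_succ : ∀ n, K (n + 1) ⊓ LinearMap.ker (d (n + 1)) = (K n).map (d n)) :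
    cohomologySeries d K = 0 := by
  ext (_ | n)
  · simp [coeff_zero_cohomologySeries, h_zero]
  · rw [coeff_succ_cohomologySeries, h_succ, sub_self, map_zero]

theorem hilbertSeries_eq_add (f : ∀ n, Module.End k (V n)) (K : ∀ n, Submodule k (V n)) :
    hilbertSeries K =
      hilbertSeries (fun n => (K n).map (f n)) +
        hilbertSeries fun n => K n ⊓ LinearMap.ker (f n) := by
  ext n
  simp [hilbertSeries, ← finrank_map_add_finrank_inf_ker (f n) (K n)]

theorem cohomologySeries_eq_add {f : ∀ n, Module.End k (V n)}
    (h_comm : ∀ n v, d n (f n v) = f (n + 1) (d n v)) (h_mem : ∀ n, ∀ v ∈ K n, f n v ∈ K n)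
    (hf : ∀ n v, f n (f n v) = 0 → f n v = 0) :
    cohomologySeries d K =
      cohomologySeries d (fun n => (K n).map (f n)) +
        cohomologySeries d fun n => K n ⊓ LinearMap.ker (f n) := by
  have h_map : ∀ n, (K n).map (f n) ⊓ LinearMap.ker (d n) =
      (K n ⊓ LinearMap.ker (d n)).map (f n) := by
    refine fun n => le_antisymm ?_ ?_
    · rintro v ⟨hv, hdv⟩
      rw [SetLike.mem_coe, ← map_map_eq_map_of_forall_mem (h_mem n) fun v _ => hf n v] at hv
      obtain ⟨_, ⟨u, hu, rfl⟩, rfl⟩ := hv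
      refine ⟨f n u, ⟨h_mem n u hu, ?_⟩, rfl⟩
      rw [SetLike.mem_coe, LinearMap.mem_ker, h_comm] at hdv ⊢
      rw [h_comm] at hdv
      exact hf _ _ hdv
    · rintro _ ⟨v, ⟨hv, hdv⟩, rfl⟩
      exact ⟨mem_map_of_mem hv, by simp_all⟩
  simp only [cohomologySeries, h_map, hilbertSeries_eq_add f K, inf_right_comm _ _ (f _).ker,
    hilbertSeries_eq_add f fun n => K n ⊓ LinearMap.ker (d n)]
  ring

end LinearAlgebra

section Contraction

variable {k L M : Type*} [CommRing k] [AddCommGroup L] [Module k L] [AddCommGroup M] [Module k M]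
  {n : ℕ}

/-- The contraction (interior product) `ι_x F = F (x, ·, …, ·)`, linear in `x` and in `F`. -/
def contr : L →ₗ[k] (L [⋀^Fin (n + 1)]→ₗ[k] M) →ₗ[k] L [⋀^Fin n]→ₗ[k] M :=
  AlternatingMap.curryLeftLinearMap.flip

@[simp]
theorem contr_apply (x : L) (F : L [⋀^Fin (n + 1)]→ₗ[k] M) (g : Fin n → L) :
    contr x F g = F (Fin.cons x g) := rfl

theorem ext_contr {F G : L [⋀^Fin (n + 1)]→ₗ[k] M} (h : ∀ x, contr x F = contr x G) : F = G := by
  ext g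
  rw [← Fin.cons_self_tail g, ← contr_apply, ← contr_apply, h]

theorem contr_contr_self (x : L) (F : L [⋀^Fin (n + 2)]→ₗ[k] M) : contr x (contr x F) = 0 :=
  F.curryLeft_same x

theorem contr_contr_comm (x y : L) (F : L [⋀^Fin (n + 2)]→ₗ[k] M) :
    contr x (contr y F) = -contr y (contr x F) := by
  have h := contr_contr_self (x + y) F
  simp only [map_add, LinearMap.add_apply, contr_contr_self, zero_add, add_zero] at h
  exact eq_neg_of_add_eq_zero_left (by rwa [add_comm])

theorem neg_one_pow_smul_map_cons_removeNth (F : L [⋀^Fin (n + 1)]→ₗ[k] M) (y : L)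
    (g : Fin (n + 1) → L) (l : Fin (n + 1)) :
    (-1 : k) ^ (l : ℕ) • F (Fin.cons y (l.removeNth g)) = F (Function.update g l y) := by
  rw [← Fin.insertNth_removeNth l y g, F.map_insertNth, ← Int.cast_smul_eq_zsmul k]
  push_cast
  rfl

theorem removeNth_succ_cons {α : Type*} (x : α) (g : Fin (n + 1) → α) (l : Fin (n + 1)) :
    l.succ.removeNth (Fin.cons x g : Fin (n + 2) → α) = Fin.cons x (l.removeNth g) :=
  Fin.cons_comp_succ_succAbove x g l

theorem contr_alternatizeUncurryFin_zero (A : L →ₗ[k] L [⋀^Fin 0]→ₗ[k] M) (x : L) :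
    contr x (AlternatingMap.alternatizeUncurryFin A) = A x := by
  ext g
  simp [AlternatingMap.alternatizeUncurryFin_apply]

theorem contr_alternatizeUncurryFin_succ (A : L →ₗ[k] L [⋀^Fin (n + 1)]→ₗ[k] M) (x : L) :
    contr x (AlternatingMap.alternatizeUncurryFin A) =
      A x - AlternatingMap.alternatizeUncurryFin (contr x ∘ₗ A) := by
  ext g
  simp [AlternatingMap.alternatizeUncurryFin_apply, Fin.sum_univ_succ, removeNth_succ_cons,
    pow_succ, sub_eq_add_neg]

/-- The forms annihilated by `ι_x`; on `0`-forms `ι_x` counts as zero. -/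
def kerContr (x : L) : ∀ n, Submodule k (L [⋀^Fin n]→ₗ[k] M)
  | 0 => ⊤
  | _ + 1 => LinearMap.ker (contr x)

theorem apply_eq_zero_of_mem_kerContr {x : L} {F : L [⋀^Fin n]→ₗ[k] M} (hF : F ∈ kerContr x n)
    {g : Fin n → L} {l : Fin n} (hl : g l = x) : F g = 0 := by
  cases n with
  | zero => exact l.elim0
  | succ n =>
    have h := neg_one_pow_smul_map_cons_removeNth F x g l
    rw [← contr_apply, show contr x F = 0 from hF, Function.update_eq_self_iff.2 hl.symm] at h
    simpa using h.symm

theorem exists_forall_contr_eq (A : L →ₗ[k] L [⋀^Fin n]→ₗ[k] M)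
    (hA : ∀ x, A x ∈ kerContr x n) : ∃ G : L [⋀^Fin (n + 1)]→ₗ[k] M, ∀ x, contr x G = A x := by
  refine ⟨{ toMultilinearMap :=
              LinearMap.uncurryLeft (AlternatingMap.toMultilinearMapLM (S := k) ∘ₗ A)
            map_eq_zero_of_eq' := fun v i j hv hij => ?_ }, fun x => rfl⟩
  change A (v 0) (Fin.tail v) = 0
  cases i using Fin.cases with
  | zero =>
    obtain ⟨j, rfl⟩ := Fin.exists_succ_eq.2 hij.symm
    exact apply_eq_zero_of_mem_kerContr (hA _) hv.symm
  | succ i =>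
    cases j using Fin.cases with
    | zero => exact apply_eq_zero_of_mem_kerContr (hA _) hv
    | succ j => exact (A (v 0)).map_eq_zero_of_eq _ hv (by simpa using hij)

/-- Exterior multiplication `ξ ∧ F` by a linear form, linear in `ξ` and in `F`. -/
def wedge : (L →ₗ[k] k) →ₗ[k] (L [⋀^Fin n]→ₗ[k] M) →ₗ[k] L [⋀^Fin (n + 1)]→ₗ[k] M :=
  LinearMap.smulRightₗ.compr₂ AlternatingMap.alternatizeUncurryFinLM

theorem contr_wedge_zero (ξ : L →ₗ[k] k) (x : L) (F : L [⋀^Fin 0]→ₗ[k] M) :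
    contr x (wedge ξ F) = ξ x • F :=
  contr_alternatizeUncurryFin_zero (ξ.smulRight F) x

theorem contr_wedge_succ (ξ : L →ₗ[k] k) (x : L) (F : L [⋀^Fin (n + 1)]→ₗ[k] M) :
    contr x (wedge ξ F) = ξ x • F - wedge ξ (contr x F) := by
  refine (contr_alternatizeUncurryFin_succ (ξ.smulRight F) x).trans ?_
  congr 2

theorem contr_wedge_of_mem_kerContr {ξ : L →ₗ[k] k} {x : L} {F : L [⋀^Fin n]→ₗ[k] M}
    (hF : F ∈ kerContr x n) : contr x (wedge ξ F) = ξ x • F := by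
  cases n with
  | zero => exact contr_wedge_zero ξ x F
  | succ n => rw [contr_wedge_succ, show contr x F = 0 from hF, map_zero, sub_zero]

theorem eq_zero_of_forall_mem {S : Set L} (hS : span k S = ⊤) {F : L [⋀^Fin n]→ₗ[k] M}
    (h : ∀ g : Fin n → L, (∀ l, g l ∈ S) → F g = 0) : F = 0 := by
  induction n with
  | zero => exact AlternatingMap.ext fun g => h g fun l => l.elim0
  | succ n ih =>
    have h_contr : contr.flip F = 0 := LinearMap.ext_on hS fun x hx => ih fun g hg =>
      h (Fin.cons x g) (Fin.cases hx hg)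
    exact ext_contr fun x => by simpa using LinearMap.congr_fun h_contr x

/-- The form `ξ₀ ∧ ⋯ ∧ ξ_{n-1} ⊗ y`. -/
def wedgeProd : ∀ {n}, (Fin n → L →ₗ[k] k) → M → L [⋀^Fin n]→ₗ[k] M
  | 0, _, y => AlternatingMap.constOfIsEmpty k L (Fin 0) y
  | _ + 1, ξ, y => wedge (ξ 0) (wedgeProd (Fin.tail ξ) y)

theorem wedgeProd_mem_kerContr {ξ : Fin n → L →ₗ[k] k} {x : L} (h : ∀ i, ξ i x = 0) (y : M) :
    wedgeProd ξ y ∈ kerContr x n := by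
  induction n with
  | zero => exact mem_top
  | succ n ih =>
    change contr x (wedge (ξ 0) _) = 0
    rw [contr_wedge_of_mem_kerContr (ih (ξ := Fin.tail ξ) fun i => h i.succ), h, zero_smul]

theorem wedgeProd_apply_dual {ξ : Fin n → L →ₗ[k] k} {g : Fin n → L} (h_self : ∀ i, ξ i (g i) = 1)
    (h_ne : ∀ i j, i ≠ j → ξ i (g j) = 0) (y : M) : wedgeProd ξ y g = y := by
  induction n with
  | zero => rfl
  | succ n ih =>
    have h_mem : wedgeProd (Fin.tail ξ) y ∈ kerContr (g 0) n :=
      wedgeProd_mem_kerContr (fun i => h_ne i.succ 0 i.succ_ne_zero) y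
    have h_tail : wedgeProd (Fin.tail ξ) y (Fin.tail g) = y :=
      ih (fun i => h_self i.succ) fun i j hij => h_ne _ _ (Fin.succ_injective n |>.ne hij)
    rw [← Fin.cons_self_tail g, ← contr_apply, wedgeProd, contr_wedge_of_mem_kerContr h_mem,
      h_self, one_smul, h_tail]

end Contraction

section LieDerivative

variable {k L M : Type*} [CommRing k] [LieRing L] [LieAlgebra k L]
  [AddCommGroup M] [Module k M] {n : ℕ}

/-- The action `∑ F (g₀, …, φ g_l, …, g_{n-1})` of an endomorphism `φ` on a form, as a
derivation. -/
def derivForm (φ : L →ₗ[k] L) : ∀ {n}, (L [⋀^Fin n]→ₗ[k] M) → L [⋀^Fin n]→ₗ[k] M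
  | 0, _ => 0
  | _ + 1, F => AlternatingMap.alternatizeUncurryFin (F.curryLeft ∘ₗ φ)

theorem derivForm_apply (φ : L →ₗ[k] L) (F : L [⋀^Fin n]→ₗ[k] M) (g : Fin n → L) :
    derivForm φ F g = ∑ l, F (Function.update g l (φ (g l))) := by
  cases n with
  | zero => simp [derivForm]
  | succ n =>
    simp only [derivForm, AlternatingMap.alternatizeUncurryFin_apply,
      ← neg_one_pow_smul_map_cons_removeNth, ← Int.cast_smul_eq_zsmul k]
    push_cast
    rfl

variable [LieRingModule L M] [LieModule k L M]

/-- The Lie derivative `L_x` on forms, that is, the action of `x` on cochains. -/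
def lieDer : L →ₗ[k] Module.End k (L [⋀^Fin n]→ₗ[k] M) :=
  LinearMap.mk₂ k
    (fun x F => (LieModule.toEnd k L M x).compAlternatingMap F - derivForm (LieAlgebra.ad k L x) F)
    (fun _ _ _ => by ext; simp [derivForm_apply, Finset.sum_add_distrib]; abel)
    (fun _ _ _ => by ext; simp [derivForm_apply, Finset.smul_sum, smul_sub])
    (fun _ _ _ => by ext; simp [derivForm_apply, Finset.sum_add_distrib]; abel)
    (fun _ _ _ => by ext; simp [derivForm_apply, Finset.smul_sum, smul_sub])

theorem lieDer_apply (x : L) (F : L [⋀^Fin n]→ₗ[k] M) (g : Fin n → L) :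
    lieDer x F g = ⁅x, F g⁆ - ∑ l, F (Function.update g l ⁅x, g l⁆) := by
  simp [lieDer, derivForm_apply]

theorem contr_lieDer (x y : L) (F : L [⋀^Fin (n + 1)]→ₗ[k] M) :
    contr y (lieDer x F) = lieDer x (contr y F) - contr ⁅x, y⁆ F := by
  ext g
  simp only [contr_apply, lieDer_apply, Fin.sum_univ_succ, Fin.cons_zero, Fin.cons_succ,
    Fin.update_cons_zero, ← Fin.cons_update, AlternatingMap.sub_apply]
  abel

theorem lieDer_lieDer (x y : L) (F : L [⋀^Fin n]→ₗ[k] M) :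
    lieDer x (lieDer y F) = lieDer y (lieDer x F) + lieDer ⁅x, y⁆ F := by
  induction n with
  | zero =>
    ext g
    simp [lieDer_apply]
  | succ n ih =>
    refine ext_contr fun z => ?_
    simp only [contr_lieDer, map_add, map_sub, LinearMap.sub_apply, ih, lie_lie x y z]
    abel

theorem lieDer_wedge (ξ : L →ₗ[k] k) (x : L) (F : L [⋀^Fin n]→ₗ[k] M) :
    lieDer x (wedge ξ F) = wedge ξ (lieDer x F) - wedge (ξ ∘ₗ LieAlgebra.ad k L x) F := by
  induction n with
  | zero =>
    refine ext_contr fun y => ?_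
    simp only [contr_lieDer, contr_wedge_zero, map_smul, map_sub, LinearMap.comp_apply,
      LieAlgebra.ad_apply]
  | succ n ih =>
    refine ext_contr fun y => ?_
    simp only [contr_lieDer, contr_wedge_succ, map_sub, ih, map_smul, LinearMap.comp_apply,
      LieAlgebra.ad_apply]
    abel

theorem lieDer_wedgeProd {ξ : Fin n → L →ₗ[k] k} {x : L} {w : Fin n → k} {u : k} {y : M}
    (hξ : ∀ i, ξ i ∘ₗ LieAlgebra.ad k L x = w i • ξ i) (hy : ⁅x, y⁆ = u • y) :
    lieDer x (wedgeProd ξ y) = (u - ∑ i, w i) • wedgeProd ξ y := by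
  induction n with
  | zero =>
    ext g
    simp [lieDer_apply, wedgeProd, hy]
  | succ n ih =>
    rw [wedgeProd, lieDer_wedge, ih (ξ := Fin.tail ξ) fun i => hξ i.succ, hξ, Fin.sum_univ_succ,
      map_smul, map_smul, LinearMap.smul_apply, ← sub_smul, add_comm (w 0), ← sub_sub]

theorem lieDer_apply_of_forall_lie_eq_smul {x : L} {g : Fin n → L} {w : Fin n → k}
    (h : ∀ l, ⁅x, g l⁆ = w l • g l) (F : L [⋀^Fin n]→ₗ[k] M) :
    lieDer x F g = ⁅x, F g⁆ - (∑ l, w l) • F g := by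
  simp [lieDer_apply, h, Finset.sum_smul]

theorem lieDer_eq_zero_of_lieDer_lieDer_eq_zero {S : Set L} (hS : span k S = ⊤) {x : L}
    (h_eigen : ∀ s ∈ S, ∃ c : k, ⁅x, s⁆ = c • s)
    (h_ss : ∀ (c : k) (m : M), ⁅x, ⁅x, m⁆ - c • m⁆ = c • (⁅x, m⁆ - c • m) → ⁅x, m⁆ = c • m)
    {F : L [⋀^Fin n]→ₗ[k] M} (hF : lieDer x (lieDer x F) = 0) : lieDer x F = 0 := by
  refine eq_zero_of_forall_mem hS fun g hg => ?_
  choose w hw using fun l => h_eigen (g l) (hg l)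
  have h := DFunLike.congr_fun hF g
  simp only [lieDer_apply_of_forall_lie_eq_smul hw, AlternatingMap.zero_apply] at h ⊢
  exact sub_eq_zero.2 (h_ss _ _ (sub_eq_zero.1 h))

end LieDerivative

section Coboundary

variable {k L M : Type*} [CommRing k] [LieRing L] [LieAlgebra k L]
  [AddCommGroup M] [Module k M] {n : ℕ}

theorem ceBracketTerm_cons (F : L [⋀^Fin (n + 1)]→ₗ[k] M) (x : L) (g : Fin (n + 1) → L) :
    ceBracketTerm k L M F (Fin.cons x g : Fin (n + 2) → L) =
      -∑ l, F (Function.update g l ⁅x, g l⁆) - ceBracketTerm k L M (contr x F) g := by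
  have h_first : ∀ l : Fin (n + 1), (-1 : k) ^ (0 + ((l : ℕ) + 1)) •
      F (Fin.cons ⁅x, g l⁆ fun m => g (l.succAbove m)) = -F (Function.update g l ⁅x, g l⁆) := by
    intro l
    rw [zero_add, pow_succ, mul_neg_one, neg_smul]
    exact congrArg _ (neg_one_pow_smul_map_cons_removeNth F _ g l)
  cases n with
  | zero => simpa [ceBracketTerm] using h_first 0
  | succ n =>
    have h_rest : ∀ (l : Fin (n + 2)) (i : Fin (n + 1)),
        (-1 : k) ^ ((i : ℕ) + 1 + ((l : ℕ) + 1)) • F (Fin.cons ⁅g i.castSucc, g l⁆ fun m =>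
            (Fin.cons x g : Fin (n + 3) → L) (l.succ.succAbove (i.succ.succAbove m))) =
          -((-1 : k) ^ ((i : ℕ) + l) •
            contr x F (Fin.cons ⁅g i.castSucc, g l⁆ fun m => g (l.succAbove (i.succAbove m)))) := by
      intro l i
      have h_args : (fun m => (Fin.cons x g : Fin (n + 3) → L) (l.succ.succAbove
          (i.succ.succAbove m))) = Fin.cons x fun m => g (l.succAbove (i.succAbove m)) :=
        (congrArg i.succ.removeNth (removeNth_succ_cons x g l)).trans
          (removeNth_succ_cons x (l.removeNth g) i)
      have h_swap := DFunLike.congr_fun (contr_contr_comm ⁅g i.castSucc, g l⁆ x F)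
        fun m => g (l.succAbove (i.succAbove m))
      simp only [contr_apply, AlternatingMap.neg_apply] at h_swap
      rw [h_args, contr_apply, h_swap, smul_neg, neg_neg]
      congr 1
      ring
    simp only [ceBracketTerm]
    rw [Fin.sum_univ_succ, Finset.sum_eq_zero fun i _ => if_neg (Fin.not_lt_zero _), zero_add,
      sub_eq_add_neg, ← Finset.sum_neg_distrib, ← Finset.sum_neg_distrib,
      ← Finset.sum_add_distrib]
    refine Finset.sum_congr rfl fun l _ => ?_
    rw [Fin.sum_univ_succ, if_pos (by simp), ← Finset.sum_neg_distrib]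
    refine congrArg₂ (· + ·) (by simpa using h_first l) (Finset.sum_congr rfl fun i _ => ?_)
    simp only [← Fin.succ_castSucc, Fin.succ_lt_succ_iff, Fin.cons_succ, Fin.val_succ, h_rest,
      neg_ite, neg_zero]

variable [LieRingModule L M] [LieModule k L M]

theorem ceDelta_apply (F : L [⋀^Fin n]→ₗ[k] M) (g : Fin (n + 1) → L) :
    ceDelta k L M n F g =
      ∑ i : Fin (n + 1), (-1 : k) ^ (i : ℕ) • ⁅g i, F (i.removeNth g)⁆ +
        ceBracketTerm k L M F g := rfl

theorem ceDelta_cons_zero (F : L [⋀^Fin 0]→ₗ[k] M) (x : L) (g : Fin 0 → L) :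
    ceDelta k L M 0 F (Fin.cons x g) = lieDer x F g := by
  simp [ceDelta_apply, ceBracketTerm, lieDer_apply, Fin.removeNth_zero]

theorem ceDelta_cons_succ (F : L [⋀^Fin (n + 1)]→ₗ[k] M) (x : L) (g : Fin (n + 1) → L) :
    ceDelta k L M (n + 1) F (Fin.cons x g) =
      lieDer x F g - ceDelta k L M n (contr x F) g := by
  rw [ceDelta_apply, ceDelta_apply, ceBracketTerm_cons, lieDer_apply, Fin.sum_univ_succ]
  simp only [removeNth_succ_cons, contr_apply, Fin.cons_succ, Fin.val_succ, pow_succ, mul_neg_one,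
    neg_smul, Finset.sum_neg_distrib, Fin.cons_zero, Fin.removeNth_zero, Fin.tail_cons,
    Fin.val_zero, pow_zero, one_smul]
  abel

theorem exists_linearMap_of_forall_exists_eq_ceDelta
    (h : ∀ F : L [⋀^Fin n]→ₗ[k] M,
      ∃ G : L [⋀^Fin (n + 1)]→ₗ[k] M, ∀ g, G g = ceDelta k L M n F g) :
    ∃ D : (L [⋀^Fin n]→ₗ[k] M) →ₗ[k] L [⋀^Fin (n + 1)]→ₗ[k] M,
      ∀ F g, D F g = ceDelta k L M n F g := by
  choose D hD using h
  exact ⟨{ toFun := D, map_add' := fun F G => by ext; simp [hD],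
           map_smul' := fun c F => by ext; simp [hD] }, hD⟩

variable (k L M) in
theorem exists_linearMap_eq_ceDelta (n : ℕ) :
    ∃ D : (L [⋀^Fin n]→ₗ[k] M) →ₗ[k] L [⋀^Fin (n + 1)]→ₗ[k] M,
      ∀ F g, D F g = ceDelta k L M n F g := by
  induction n with
  | zero =>
    refine exists_linearMap_of_forall_exists_eq_ceDelta fun F => ?_
    obtain ⟨G, hG⟩ := exists_forall_contr_eq (lieDer.flip F) fun _ => mem_top
    refine ⟨G, fun g => ?_⟩
    rw [← Fin.cons_self_tail g, ← contr_apply, hG, ceDelta_cons_zero, LinearMap.flip_apply]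
  | succ n ih =>
    obtain ⟨D, hD⟩ := ih
    refine exists_linearMap_of_forall_exists_eq_ceDelta fun F => ?_
    have h_contr : ∀ x, contr x (lieDer x F - D (contr x F)) = 0 := by
      intro x
      have h_lie : contr x (lieDer x F) = lieDer x (contr x F) := by
        rw [contr_lieDer, lie_self, map_zero, LinearMap.zero_apply, sub_zero]
      ext g
      rw [map_sub, h_lie, AlternatingMap.sub_apply, contr_apply _ (D _), hD]
      cases n with
      | zero => simp [ceDelta_cons_zero]
      | succ n => simp [ceDelta_cons_succ, contr_contr_self]
    obtain ⟨G, hG⟩ := exists_forall_contr_eq (lieDer.flip F - D ∘ₗ contr.flip F) h_contr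
    refine ⟨G, fun g => ?_⟩
    rw [← Fin.cons_self_tail g, ← contr_apply, hG, ceDelta_cons_succ, ← hD]
    rfl

/-- The Chevalley–Eilenberg coboundary with values in alternating maps. -/
noncomputable def ceD : (L [⋀^Fin n]→ₗ[k] M) →ₗ[k] L [⋀^Fin (n + 1)]→ₗ[k] M :=
  (exists_linearMap_eq_ceDelta k L M n).choose

theorem ceD_apply (F : L [⋀^Fin n]→ₗ[k] M) (g : Fin (n + 1) → L) :
    ceD F g = ceDelta k L M n F g :=
  (exists_linearMap_eq_ceDelta k L M n).choose_spec F g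

theorem contr_ceD_zero (x : L) (F : L [⋀^Fin 0]→ₗ[k] M) : contr x (ceD F) = lieDer x F := by
  ext g
  rw [contr_apply, ceD_apply, ceDelta_cons_zero]

theorem contr_ceD_succ (x : L) (F : L [⋀^Fin (n + 1)]→ₗ[k] M) :
    contr x (ceD F) = lieDer x F - ceD (contr x F) := by
  ext g
  rw [contr_apply, ceD_apply, ceDelta_cons_succ, AlternatingMap.sub_apply, ceD_apply]

theorem ceD_lieDer (x : L) (F : L [⋀^Fin n]→ₗ[k] M) : ceD (lieDer x F) = lieDer x (ceD F) := by
  induction n with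
  | zero =>
    refine ext_contr fun y => ?_
    rw [contr_lieDer, contr_ceD_zero, contr_ceD_zero, contr_ceD_zero, lieDer_lieDer x y]
    abel
  | succ n ih =>
    refine ext_contr fun y => ?_
    rw [contr_lieDer, contr_ceD_succ, contr_ceD_succ, contr_ceD_succ, contr_lieDer, map_sub,
      map_sub, ih, lieDer_lieDer x y]
    abel

theorem ceD_ceD (F : L [⋀^Fin n]→ₗ[k] M) : ceD (ceD F) = 0 := by
  induction n with
  | zero =>
    refine ext_contr fun y => ?_
    rw [contr_ceD_succ, contr_ceD_zero, ceD_lieDer, sub_self, map_zero]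
  | succ n ih =>
    refine ext_contr fun y => ?_
    rw [contr_ceD_succ, contr_ceD_succ, map_sub, ih, ceD_lieDer, sub_zero, sub_self, map_zero]

theorem ceCocycles_eq_ker_ceD : ceCocycles k L M n = LinearMap.ker ceD := by
  ext F
  simp only [ceCocycles, LinearMap.mem_ker, funext_iff, AlternatingMap.ext_iff, ceD_apply,
    AlternatingMap.zero_apply, Pi.zero_apply]

theorem ceCoboundaries_succ_eq_range_ceD :
    ceCoboundaries k L M (n + 1) = LinearMap.range (ceD (k := k) (L := L) (M := M) (n := n)) := by
  ext F
  change (∃ G : L [⋀^Fin n]→ₗ[k] M, ∀ g, F g = ceDelta k L M n G g) ↔ _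
  simp only [← ceD_apply, LinearMap.mem_range, ← AlternatingMap.ext_iff, eq_comm]

variable {ξ : L →ₗ[k] k} (hξ : ∀ x y : L, ξ ⁅x, y⁆ = 0)
include hξ

theorem lieDer_wedge_of_closed (x : L) (F : L [⋀^Fin n]→ₗ[k] M) :
    lieDer x (wedge ξ F) = wedge ξ (lieDer x F) := by
  have h : ξ ∘ₗ LieAlgebra.ad k L x = 0 := LinearMap.ext (hξ x)
  rw [lieDer_wedge, h, map_zero, LinearMap.zero_apply, sub_zero]

theorem ceD_wedge (F : L [⋀^Fin n]→ₗ[k] M) : ceD (wedge ξ F) = -wedge ξ (ceD F) := by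
  induction n with
  | zero =>
    refine ext_contr fun y => ?_
    rw [map_neg, contr_wedge_succ, contr_ceD_succ, contr_ceD_zero, contr_wedge_zero,
      lieDer_wedge_of_closed hξ, map_smul]
    abel
  | succ n ih =>
    refine ext_contr fun y => ?_
    rw [map_neg, contr_wedge_succ, contr_ceD_succ, contr_ceD_succ, contr_wedge_succ,
      lieDer_wedge_of_closed hξ, map_sub, map_sub, ih, map_smul]
    abel

end Coboundary

section Torus

variable {k L M : Type*} [Field k] [LieRing L] [LieAlgebra k L] [AddCommGroup M] [Module k M]
  {n : ℕ}

instance [FiniteDimensional k L] [FiniteDimensional k M] :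
    FiniteDimensional k (L [⋀^Fin n]→ₗ[k] M) :=
  Module.Finite.equiv exteriorPower.alternatingMapLinearEquiv.symm

theorem hilbertSeries_of_contr_mem_of_wedge_mem [FiniteDimensional k L] [FiniteDimensional k M]
    {K : ∀ n, Submodule k (L [⋀^Fin n]→ₗ[k] M)} {ξ : L →ₗ[k] k} {x : L} (hξ : ξ x = 1)
    (h_contr : ∀ n, ∀ F ∈ K (n + 1), contr x F ∈ K n)
    (h_wedge : ∀ n, ∀ F ∈ K n, wedge ξ F ∈ K (n + 1)) :
    hilbertSeries K = (1 + X) * hilbertSeries fun n => K n ⊓ kerContr x n := by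
  have h_map : ∀ n, (K (n + 1)).map (contr x) = K n ⊓ kerContr x n := by
    refine fun n => le_antisymm ?_ fun F ⟨hF, hF'⟩ =>
      ⟨wedge ξ F, h_wedge n F hF, by rw [contr_wedge_of_mem_kerContr hF', hξ, one_smul]⟩
    rintro _ ⟨F, hF, rfl⟩
    refine ⟨h_contr n F hF, ?_⟩
    cases n with
    | zero => exact mem_top
    | succ n => exact contr_contr_self x F
  ext (_ | n)
  · have h_zero : K 0 ⊓ kerContr x 0 = K 0 := inf_top_eq _
    simpa [hilbertSeries, add_mul] using congrArg (fun S : Submodule k _ => finrank k S) h_zero.symm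
  · have := finrank_map_add_finrank_inf_ker (contr x) (K (n + 1))
    rw [h_map, add_comm] at this
    simp only [hilbertSeries, add_mul, one_mul, map_add, coeff_mk, coeff_succ_X_mul, ← this,
      Nat.cast_add]
    rfl

variable [LieRingModule L M] [LieModule k L M]

theorem contr_ceD_of_lieDer_eq_zero {x : L} {F : L [⋀^Fin (n + 1)]→ₗ[k] M}
    (h : lieDer x F = 0) : contr x (ceD F) = -ceD (contr x F) := by
  rw [contr_ceD_succ, h, zero_sub]

variable {K : ∀ n, Submodule k (L [⋀^Fin n]→ₗ[k] M)} {x : L}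

theorem lieDer_mem (h_contr : ∀ n, ∀ F ∈ K (n + 1), contr x F ∈ K n)
    (h_ceD : ∀ n, ∀ F ∈ K n, ceD F ∈ K (n + 1)) (n : ℕ) (F : L [⋀^Fin n]→ₗ[k] M) (hF : F ∈ K n) :
    lieDer x F ∈ K n := by
  have h := h_contr n _ (h_ceD n F hF)
  cases n with
  | zero => rwa [contr_ceD_zero] at h
  | succ n => simpa [contr_ceD_succ] using add_mem h (h_ceD n _ (h_contr n F hF))

/-- The Poincaré series of the cohomology of a subcomplex of the Chevalley–Eilenberg complex. -/
noncomputable abbrev ceCohomologySeries (K : ∀ n, Submodule k (L [⋀^Fin n]→ₗ[k] M)) : ℤ⟦X⟧ :=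
  cohomologySeries (V := fun n => L [⋀^Fin n]→ₗ[k] M) (fun _ => ceD) K

variable [FiniteDimensional k L] [FiniteDimensional k M]

theorem finrank_ceCohomology (n : ℕ) :
    (finrank k (ceCohomology k L M n) : ℤ) =
      coeff n (ceCohomologySeries fun n => (⊤ : Submodule k (L [⋀^Fin n]→ₗ[k] M))) := by
  cases n with
  | zero =>
    rw [finrank_quotient_submoduleOf (B := ceCoboundaries k L M 0) bot_le,
      coeff_zero_cohomologySeries, ceCocycles_eq_ker_ceD, top_inf_eq, ceCoboundaries, finrank_bot,
      Nat.cast_zero, sub_zero]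
  | succ n =>
    have h_le : LinearMap.range (ceD (k := k) (L := L) (M := M) (n := n)) ≤ LinearMap.ker ceD :=
      LinearMap.range_le_ker_iff.2 (LinearMap.ext ceD_ceD)
    rw [finrank_quotient_submoduleOf, coeff_succ_cohomologySeries, ceCocycles_eq_ker_ceD,
      ceCoboundaries_succ_eq_range_ceD, top_inf_eq, Submodule.map_top]
    rwa [ceCocycles_eq_ker_ceD, ceCoboundaries_succ_eq_range_ceD]

theorem ceCohomologySeries_inf_kerContr {ξ : L →ₗ[k] k} (hξ : ∀ x y : L, ξ ⁅x, y⁆ = 0)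
    (hx : ξ x = 1) (h_lieDer : ∀ n, ∀ F ∈ K n, lieDer x F = 0)
    (h_contr : ∀ n, ∀ F ∈ K (n + 1), contr x F ∈ K n)
    (h_wedge : ∀ n, ∀ F ∈ K n, wedge ξ F ∈ K (n + 1)) :
    ceCohomologySeries K =
      (1 + X) * ceCohomologySeries fun n => K n ⊓ kerContr x n := by
  have h_cocycles := hilbertSeries_of_contr_mem_of_wedge_mem
    (K := fun n => K n ⊓ LinearMap.ker ceD) hx
    (fun n F hF => ⟨h_contr n F hF.1, by
      have := contr_ceD_of_lieDer_eq_zero (h_lieDer _ F hF.1)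
      rwa [show ceD F = 0 from hF.2, map_zero, zero_eq_neg] at this⟩)
    (fun n F hF => ⟨h_wedge n F hF.1, by
      rw [SetLike.mem_coe, LinearMap.mem_ker, ceD_wedge hξ, show ceD F = 0 from hF.2, map_zero,
        neg_zero]⟩)
  simp only [cohomologySeries, h_cocycles, inf_right_comm _ (LinearMap.ker ceD),
    hilbertSeries_of_contr_mem_of_wedge_mem hx h_contr h_wedge]
  ring

theorem ceCohomologySeries_inf_ker_lieDer
    (h_contr : ∀ n, ∀ F ∈ K (n + 1), contr x F ∈ K n)
    (h_ceD : ∀ n, ∀ F ∈ K n, ceD F ∈ K (n + 1))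
    (hx : ∀ n (F : L [⋀^Fin n]→ₗ[k] M), lieDer x (lieDer x F) = 0 → lieDer x F = 0) :
    ceCohomologySeries K =
      ceCohomologySeries fun n => K n ⊓ LinearMap.ker (lieDer x) := by
  have h_mem := lieDer_mem h_contr h_ceD
  have h_prim : ∀ n, ∀ F ∈ (K n).map (lieDer x) ⊓ LinearMap.ker ceD,
      ∃ G ∈ K n, ceD (lieDer x G) = 0 ∧ F = lieDer x (lieDer x G) := by
    rintro n F ⟨hF, hdF⟩
    rw [SetLike.mem_coe, ← map_map_eq_map_of_forall_mem (h_mem n) fun F _ => hx n F] at hF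
    obtain ⟨_, ⟨G, hG, rfl⟩, rfl⟩ := hF
    refine ⟨G, hG, ?_, rfl⟩
    rw [SetLike.mem_coe, LinearMap.mem_ker, ceD_lieDer, ceD_lieDer] at hdF
    rw [ceD_lieDer, hx _ _ hdF]
  refine (cohomologySeries_eq_add (V := fun n => L [⋀^Fin n]→ₗ[k] M)
    (fun _ => ceD_lieDer x) h_mem hx).trans (add_eq_right.2 <| cohomologySeries_eq_zero
      ((Submodule.eq_bot_iff _).2 fun F hF => ?_) fun n => le_antisymm (fun F hF => ?_) ?_)
  · obtain ⟨G, -, hdG, rfl⟩ := h_prim 0 F hF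
    rw [← contr_ceD_zero, hdG, map_zero]
  · obtain ⟨G, hG, hdG, rfl⟩ := h_prim (n + 1) F hF
    have h_comm : contr x (lieDer x G) = lieDer x (contr x G) := by
      rw [contr_lieDer, lie_self, map_zero, LinearMap.zero_apply, sub_zero]
    refine ⟨contr x (lieDer x G), ⟨_, h_contr n G hG, h_comm.symm⟩, ?_⟩
    rw [← sub_sub_cancel (lieDer x (lieDer x G)) (ceD _), ← contr_ceD_succ, hdG, map_zero, sub_zero]
  · rintro _ ⟨_, ⟨F, hF, rfl⟩, rfl⟩
    exact ⟨⟨_, h_ceD n F hF, (ceD_lieDer x F).symm⟩, ceD_ceD _⟩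

end Torus

section RelativeForms

variable {k L M ι : Type*} [Field k] [LieRing L] [LieAlgebra k L] [AddCommGroup M] [Module k M]
  [LieRingModule L M] [LieModule k L M] {H : ι → L} {n : ℕ}

variable (k M H) in
/-- The forms invariant under `H i` for `i ∈ s` and annihilated by contraction with `H i` for
`i ∈ t`. If the `H i` commute and `s = t = univ`, these are the cochains of `L` relative to the
subalgebra spanned by the `H i`. -/
def relForms (s t : Set ι) (n : ℕ) : Submodule k (L [⋀^Fin n]→ₗ[k] M) :=
  (⨅ i ∈ s, LinearMap.ker (lieDer (H i))) ⊓ ⨅ i ∈ t, kerContr (H i) n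

theorem mem_relForms {s t : Set ι} {F : L [⋀^Fin n]→ₗ[k] M} :
    F ∈ relForms k M H s t n ↔ (∀ i ∈ s, lieDer (H i) F = 0) ∧ ∀ i ∈ t, F ∈ kerContr (H i) n := by
  simp [relForms]

variable (hH : ∀ i j, ⁅H i, H j⁆ = 0)
include hH

theorem contr_mem_relForms {s t : Set ι} (j : ι) (n : ℕ) (F : L [⋀^Fin (n + 1)]→ₗ[k] M)
    (hF : F ∈ relForms k M H s t (n + 1)) : contr (H j) F ∈ relForms k M H s t n := by
  rw [mem_relForms] at hF ⊢
  refine ⟨fun i hi => ?_, fun i hi => ?_⟩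
  · have h := contr_lieDer (H i) (H j) F
    rwa [hF.1 i hi, hH, map_zero, map_zero, LinearMap.zero_apply, sub_zero, eq_comm] at h
  · cases n with
    | zero => exact mem_top
    | succ n =>
      have h : contr (H i) F = 0 := hF.2 i hi
      change contr (H i) (contr (H j) F) = 0
      rw [contr_contr_comm, h, map_zero, neg_zero]

omit hH in
theorem ceD_mem_relForms {s t : Set ι} (hst : t ⊆ s) (n : ℕ) (F : L [⋀^Fin n]→ₗ[k] M)
    (hF : F ∈ relForms k M H s t n) : ceD F ∈ relForms k M H s t (n + 1) := by
  rw [mem_relForms] at hF ⊢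
  refine ⟨fun i hi => by rw [← ceD_lieDer, hF.1 i hi, map_zero], fun i hi => ?_⟩
  change contr (H i) (ceD F) = 0
  cases n with
  | zero => rw [contr_ceD_zero, hF.1 i (hst hi)]
  | succ n =>
    rw [contr_ceD_succ, hF.1 i (hst hi), show contr (H i) F = 0 from hF.2 i hi, map_zero, sub_zero]

omit hH in
theorem wedge_mem_relForms {s t : Set ι} {ξ : L →ₗ[k] k} (hξ : ∀ x y : L, ξ ⁅x, y⁆ = 0)
    (ht : ∀ i ∈ t, ξ (H i) = 0) (n : ℕ) (F : L [⋀^Fin n]→ₗ[k] M) (hF : F ∈ relForms k M H s t n) :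
    wedge ξ F ∈ relForms k M H s t (n + 1) := by
  rw [mem_relForms] at hF ⊢
  refine ⟨fun i hi => by rw [lieDer_wedge_of_closed hξ, hF.1 i hi, map_zero], fun i hi => ?_⟩
  change contr (H i) (wedge ξ F) = 0
  cases n with
  | zero => rw [contr_wedge_zero, ht i hi, zero_smul]
  | succ n =>
    rw [contr_wedge_succ, ht i hi, show contr (H i) F = 0 from hF.2 i hi, map_zero, zero_smul,
      sub_zero]

theorem ceCohomologySeries_relForms_empty [FiniteDimensional k L] [FiniteDimensional k M]
    (h_ss : ∀ i n (F : L [⋀^Fin n]→ₗ[k] M), lieDer (H i) (lieDer (H i) F) = 0 → lieDer (H i) F = 0)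
    (s : Finset ι) :
    ceCohomologySeries (relForms k M H s ∅) =
      ceCohomologySeries fun n => (⊤ : Submodule k (L [⋀^Fin n]→ₗ[k] M)) := by
  classical
  induction s using Finset.induction_on with
  | empty => simp [funext fun n => show relForms k M H ∅ ∅ n = ⊤ by simp [relForms]]
  | insert i s _ ih =>
    rw [← ih, ceCohomologySeries_inf_ker_lieDer (K := relForms k M H s ∅) (contr_mem_relForms hH i)
      (ceD_mem_relForms (Set.empty_subset _)) (h_ss i)]
    congr! 2 with n
    ext F
    simp [mem_relForms, and_comm]

theorem ceCohomologySeries_relForms_univ_empty [FiniteDimensional k L] [FiniteDimensional k M]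
    {ξ : ι → L →ₗ[k] k} (hξ : ∀ i (x y : L), ξ i ⁅x, y⁆ = 0) (h_self : ∀ i, ξ i (H i) = 1)
    (h_ne : ∀ i j, i ≠ j → ξ i (H j) = 0) (t : Finset ι) :
    ceCohomologySeries (relForms k M H Set.univ ∅) =
      (1 + X) ^ t.card * ceCohomologySeries (relForms k M H Set.univ t) := by
  classical
  induction t using Finset.induction_on with
  | empty => simp
  | insert i t hi ih =>
    rw [ih, Finset.card_insert_of_notMem hi, pow_succ, mul_assoc,
      ceCohomologySeries_inf_kerContr (K := relForms k M H Set.univ t) (hξ i) (h_self i)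
        (fun n F hF => (mem_relForms.1 hF).1 i trivial) (contr_mem_relForms hH i)
        (wedge_mem_relForms (hξ i) fun j hj => h_ne i j (by rintro rfl; exact hi hj))]
    congr! 3 with n
    ext F
    simp [mem_relForms, and_comm, and_left_comm]

theorem ceCohomologySeries_top [FiniteDimensional k L] [FiniteDimensional k M] [Fintype ι]
    (h_ss : ∀ i n (F : L [⋀^Fin n]→ₗ[k] M), lieDer (H i) (lieDer (H i) F) = 0 → lieDer (H i) F = 0)
    {ξ : ι → L →ₗ[k] k} (hξ : ∀ i (x y : L), ξ i ⁅x, y⁆ = 0) (h_self : ∀ i, ξ i (H i) = 1)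
    (h_ne : ∀ i j, i ≠ j → ξ i (H j) = 0) :
    ceCohomologySeries (fun n => (⊤ : Submodule k (L [⋀^Fin n]→ₗ[k] M))) =
      (1 + X) ^ Fintype.card ι * ceCohomologySeries (relForms k M H Set.univ Set.univ) := by
  rw [← ceCohomologySeries_relForms_empty hH h_ss Finset.univ, Finset.coe_univ,
    ceCohomologySeries_relForms_univ_empty hH hξ h_self h_ne Finset.univ, Finset.coe_univ,
    Finset.card_univ]

end RelativeForms

section Flow

variable {P : Type*} [PartialOrder P] {n m : ℕ}

variable (P) in
/-- The edges of the nerve of `P`: the pairs `e` with `e.1.1 < e.1.2`. -/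
abbrev Edge : Type _ := {e : P × P // e.1 < e.2}

instance : FunLike (Chain P m) (Fin m) P where
  coe := Subtype.val
  coe_injective := Subtype.val_injective

theorem Chain.strictMono (c : Chain P m) : StrictMono c := c.2

theorem Chain.face_apply (c : Chain P (m + 1)) (i : Fin (m + 1)) (l : Fin m) :
    c.face i l = c (i.succAbove l) := rfl

/-- The edge from the `l`-th to the next vertex of a simplex. -/
def Chain.edge (c : Chain P (n + 1)) (l : Fin n) : Edge P :=
  ⟨(c l.castSucc, c l.succ), c.strictMono Fin.castSucc_lt_succ⟩

/-- The simplex spanned by the source of an edge and a simplex starting at its target. -/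
def Chain.cons (e : Edge P) (c : Chain P (n + 1)) (h : e.1.2 = c 0) : Chain P (n + 2) :=
  ⟨Fin.cons e.1.1 c, Fin.strictMono_iff_lt_succ.2 <| Fin.cases (by simpa [← h] using e.2)
    fun i => by simpa [← Fin.succ_castSucc] using c.strictMono Fin.castSucc_lt_succ⟩

theorem Chain.cons_edge_zero {e : Edge P} {c : Chain P (n + 1)} (h : e.1.2 = c 0) :
    (Chain.cons e c h).edge 0 = e :=
  Subtype.ext (Prod.ext rfl h.symm)

theorem Chain.cons_edge_succ {e : Edge P} {c : Chain P (n + 1)} (h : e.1.2 = c 0) (l : Fin n) :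
    (Chain.cons e c h).edge l.succ = c.edge l := rfl

theorem Chain.exists_edge_notMem_of_ne {c c' : Chain P (n + 2)} (h : c ≠ c') :
    ∃ l, ∀ i, c'.edge i ≠ c.edge l := by
  by_contra! h_edge
  refine h (Subtype.ext ((c.2.range_inj c'.2).1 (Set.eq_of_subset_of_ncard_le ?_ ?_)))
  · rintro _ ⟨l, rfl⟩
    cases l using Fin.lastCases with
    | last =>
      obtain ⟨i, hi⟩ := h_edge (Fin.last n)
      exact ⟨i.succ, congrArg (fun e : Edge P => e.1.2) hi⟩
    | cast l =>
      obtain ⟨i, hi⟩ := h_edge l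
      exact ⟨i.castSucc, congrArg (fun e : Edge P => e.1.1) hi⟩
  · rw [← Set.image_univ, ← Set.image_univ, Set.ncard_image_of_injective _ c.2.injective,
      Set.ncard_image_of_injective _ c'.2.injective]

theorem exists_perm_cons_edge {x : Fin (n + 1) → Edge P} {l : Fin (n + 1)} {c : Chain P (n + 1)}
    (h : (x l).1.2 = c 0) {σ : Equiv.Perm (Fin n)} (hσ : ∀ i, x (l.succAbove (σ i)) = c.edge i) :
    ∃ τ : Equiv.Perm (Fin (n + 1)), ∀ i, x (τ i) = (Chain.cons (x l) c h).edge i := by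
  refine ⟨((finSuccEquiv n).trans σ.optionCongr).trans (finSuccEquiv' l).symm, Fin.cases ?_ ?_⟩
  · simp [Chain.cons_edge_zero]
  · simp [Chain.cons_edge_succ, hσ]

variable [DecidableEq P]

/-- The number of edges leaving `p`. -/
def outDegree (x : Fin n → Edge P) (p : P) : ℕ := ∑ l, if (x l).1.1 = p then 1 else 0

/-- The number of edges entering `p`. -/
def inDegree (x : Fin n → Edge P) (p : P) : ℕ := ∑ l, if (x l).1.2 = p then 1 else 0

theorem exists_inDegree_eq_zero (x : Fin (n + 1) → Edge P) : ∃ l, inDegree x (x l).1.1 = 0 := by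
  obtain ⟨p, hp⟩ := (Finset.univ.image fun l => (x l).1.1).exists_minimal
    ⟨_, Finset.mem_image_of_mem _ (Finset.mem_univ 0)⟩
  obtain ⟨l, -, rfl⟩ := Finset.mem_image.1 hp.1
  refine ⟨l, Finset.sum_eq_zero fun i _ => if_neg fun hi => ?_⟩
  have h_lt : (x i).1.1 < (x l).1.1 := hi ▸ (x i).2
  exact h_lt.not_ge (hp.2 (Finset.mem_image_of_mem _ (Finset.mem_univ i)) h_lt.le)

/-- No edge ends at the source of some `x l`; by the flow condition that source is `a`, and removing
`x l` leaves a flow from its target to `b`. -/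
theorem exists_chain_of_flow {x : Fin n → Edge P} {a b : P}
    (h : ∀ p, outDegree x p + (if b = p then 1 else 0) = inDegree x p + if a = p then 1 else 0) :
    ∃ c : Chain P (n + 1), c 0 = a ∧ c (Fin.last n) = b ∧
      ∃ σ : Equiv.Perm (Fin n), ∀ l, x (σ l) = c.edge l := by
  induction n generalizing a with
  | zero =>
    obtain rfl : b = a := by simpa [outDegree, inDegree] using h a
    exact ⟨⟨fun _ => b, Subsingleton.strictMono (α := Fin 1) _⟩, rfl, rfl, 1, fun l => l.elim0⟩
  | succ n ih =>
    obtain ⟨l, hl⟩ := exists_inDegree_eq_zero x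
    have h_out : ∀ p, outDegree x p =
        (if (x l).1.1 = p then 1 else 0) + outDegree (l.removeNth x) p :=
      fun p => Fin.sum_univ_succAbove _ l
    have h_in : ∀ p, inDegree x p =
        (if (x l).1.2 = p then 1 else 0) + inDegree (l.removeNth x) p :=
      fun p => Fin.sum_univ_succAbove _ l
    obtain rfl : a = (x l).1.1 := by
      by_contra hne
      have h_source := h (x l).1.1
      rw [h_out, if_pos rfl, hl, if_neg hne] at h_source
      lia
    obtain ⟨c, hc, hcb, σ, hσ⟩ := ih (x := l.removeNth x) (a := (x l).1.2) fun p => by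
      have hp := h p
      rw [h_out, h_in] at hp
      lia
    exact ⟨Chain.cons (x l) c hc.symm, rfl, hcb, exists_perm_cons_edge hc.symm hσ⟩

variable [Fintype P] {x : Fin n → Edge P}

theorem outDegree_lt_card (hx : Function.Injective x) (p : P) : outDegree x p < Fintype.card P := by
  rw [outDegree, ← Finset.card_filter, ← Finset.card_univ, ← Finset.card_erase_add_one
    (Finset.mem_univ p), Nat.lt_succ_iff]
  refine Finset.card_le_card_of_injOn (fun l => (x l).1.2) (fun l hl => ?_) fun l hl i hi h => ?_
  · obtain rfl : (x l).1.1 = p := by simpa using hl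
    simpa using (x l).2.ne'
  · exact hx (Subtype.ext (Prod.ext (by simp_all) h))

theorem inDegree_lt_card (hx : Function.Injective x) (p : P) : inDegree x p < Fintype.card P := by
  rw [inDegree, ← Finset.card_filter, ← Finset.card_univ, ← Finset.card_erase_add_one
    (Finset.mem_univ p), Nat.lt_succ_iff]
  refine Finset.card_le_card_of_injOn (fun l => (x l).1.1) (fun l hl => ?_) fun l hl i hi h => ?_
  · obtain rfl : (x l).1.2 = p := by simpa using hl
    simpa using (x l).2.ne
  · exact hx (Subtype.ext (Prod.ext h (by simp_all)))

theorem natCast_injOn_Iic {R : Type*} [Ring R] {N : ℕ}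
    (h : ringChar R = 0 ∨ N < ringChar R) : (Set.Iic N).InjOn (Nat.cast : ℕ → R) := by
  rcases h with h | h
  · have := ringChar.of_eq h
    have := CharP.charP_to_charZero R
    exact Nat.cast_injective.injOn
  · exact (CharP.natCast_injOn_Iio R (ringChar R)).mono (Set.Iic_subset_Iio.2 h)

theorem natCast_card_ne_zero {R α : Type*} [Ring R] [Fintype α] [Nonempty α]
    (h : ringChar R = 0 ∨ Fintype.card α < ringChar R) : (Fintype.card α : R) ≠ 0 := fun h_zero =>
  Fintype.card_ne_zero <| natCast_injOn_Iic h Set.self_mem_Iic (Nat.zero_le _) <| by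
    rw [h_zero, Nat.cast_zero]

theorem exists_chain_of_flow_of_cast {k : Type*} [Ring k]
    (hk : ringChar k = 0 ∨ Fintype.card P < ringChar k) (hx : Function.Injective x) {a b : P}
    (h : ∀ p, (outDegree x p : k) + (if b = p then 1 else 0) =
      inDegree x p + if a = p then 1 else 0) :
    ∃ c : Chain P (n + 1), c 0 = a ∧ c (Fin.last n) = b ∧
      ∃ σ : Equiv.Perm (Fin n), ∀ l, x (σ l) = c.edge l := by
  refine exists_chain_of_flow fun p => natCast_injOn_Iic hk ?_ ?_ (by simpa using h p)
  · have := outDegree_lt_card hx p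
    rw [Set.mem_Iic]
    split_ifs <;> lia
  · have := inDegree_lt_card hx p
    rw [Set.mem_Iic]
    split_ifs <;> lia

end Flow

section Nerve

variable {k P : Type*} [CommRing k] [PartialOrder P] {m : ℕ}

theorem nerveDelta_apply (f : Chain P m → k) (c : Chain P (m + 1)) :
    nerveDelta k P m f c = ∑ i : Fin (m + 1), (-1 : k) ^ (i : ℕ) * f (c.face i) := rfl

theorem nerveDelta_nerveDelta (f : Chain P m → k) :
    nerveDelta k P (m + 1) (nerveDelta k P m f) = 0 := by
  funext c
  have h_face : ∀ (i : Fin (m + 2)) (j : Fin (m + 1)),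
      (c.face (i.succAbove j)).face (j.predAbove i) = (c.face i).face j := fun i j =>
    DFunLike.ext _ _ fun l => congrArg c (Fin.succAbove_succAbove_succAbove_predAbove i j l)
  have h_sign : ∀ (i : Fin (m + 2)) (j : Fin (m + 1)),
      (-1 : k) ^ (i.succAbove j + j.predAbove i : ℕ) = -(-1) ^ (i + j : ℕ) := by
    intro i j
    rw [Fin.neg_one_pow_succAbove_add_predAbove]
  simp only [nerveDelta_apply, Finset.mul_sum, ← mul_assoc, ← pow_add, Pi.zero_apply]
  rw [← Finset.sum_product']
  refine Finset.sum_involution (fun x _ => (x.1.succAbove x.2, x.2.predAbove x.1))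
    (fun x _ => ?_) (fun x _ _ h => x.1.succAbove_ne x.2 (congrArg Prod.fst h))
    (fun _ _ => Finset.mem_univ _) fun x _ => ?_
  · rw [h_face, h_sign, neg_mul, add_neg_cancel]
  · simp [Fin.succAbove_succAbove_predAbove, Fin.predAbove_predAbove_succAbove]

instance [Finite P] : Finite (Chain P m) := Finite.of_injective _ Subtype.val_injective

instance : Unique (Chain P 0) where
  default := ⟨Fin.elim0, fun l => l.elim0⟩
  uniq _ := Subtype.ext (Subsingleton.elim _ _)

theorem nerveDelta_zero_apply (f : Chain P 0 → k) (c : Chain P 1) :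
    nerveDelta k P 0 f c = f default := by
  simp [nerveDelta_apply, Unique.eq_default (c.face 0)]

/-- The `0`-simplex at a vertex. -/
def pointChain (p : P) : Chain P 1 := ⟨fun _ => p, Subsingleton.strictMono (α := Fin 1) _⟩

theorem pointChain_apply_zero (c : Chain P 1) : pointChain (c 0) = c :=
  DFunLike.ext _ _ fun l => congrArg c (Subsingleton.elim 0 l)

theorem nerveDelta_zero_injective [Nonempty P] : Function.Injective (nerveDelta k P 0) := by
  obtain ⟨p⟩ := ‹Nonempty P›
  intro f g h
  refine funext fun c => ?_
  rw [Subsingleton.elim c default, ← nerveDelta_zero_apply f (pointChain p), h,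
    nerveDelta_zero_apply]

end Nerve

section PosetAlgebra

variable {k P : Type*} [CommRing k] [DecidableEq P]

variable (k) in
/-- The weight of the matrix unit `e_{ab}` under the adjoint action of `e_{pp}`. -/
def weight (p a b : P) : k := (if a = p then 1 else 0) - if b = p then 1 else 0

@[simp]
theorem weight_self (p a : P) : weight k p a a = 0 := sub_self _

theorem sum_weight [Fintype P] (a b : P) : ∑ p, weight k p a b = 0 := by
  simp [weight]

theorem sum_weight_edge {n : ℕ} [PartialOrder P] (x : Fin n → Edge P) (p : P) :
    ∑ l, weight k p (x l).1.1 (x l).1.2 = outDegree x p - inDegree x p := by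
  simp [weight, outDegree, inDegree]

theorem sum_weight_chain {n : ℕ} [PartialOrder P] (c : Chain P (n + 1)) (p : P) :
    ∑ l, weight k p (c.edge l).1.1 (c.edge l).1.2 = weight k p (c 0) (c (Fin.last n)) := by
  simp only [weight, Chain.edge, Finset.sum_sub_distrib]
  rw [sub_eq_sub_iff_add_eq_add]
  exact (Fin.sum_univ_castSucc fun l => if c l = p then (1 : k) else 0).symm.trans
    (Fin.sum_univ_succ _)

variable [Fintype P] [PartialOrder P]

/-- The matrix entry at `(a, b)`, as a linear form. -/
def entry (a b : P) : lieAlg k P →ₗ[k] k :=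
  Matrix.entryLinearMap k k a b ∘ₗ (lieAlg k P).toSubmodule.subtype

theorem ext_entry {X Y : lieAlg k P} (h : ∀ a b, entry a b X = entry a b Y) : X = Y :=
  Subtype.ext (Matrix.ext h)

theorem entry_eq_zero (X : lieAlg k P) {a b : P} (h : ¬a ≤ b) : entry a b X = 0 :=
  X.2.1 a b h

theorem sum_entry_self (X : lieAlg k P) : ∑ a, entry a a X = 0 :=
  X.2.2

theorem entry_lie (X Y : lieAlg k P) (a b : P) :
    entry a b ⁅X, Y⁆ = ∑ c, entry a c X * entry c b Y - ∑ c, entry a c Y * entry c b X :=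
  rfl

theorem entry_self_lie (a : P) (X Y : lieAlg k P) : entry a a ⁅X, Y⁆ = 0 := by
  rw [entry_lie, ← Finset.sum_sub_distrib]
  refine Finset.sum_eq_zero fun c _ => ?_
  by_cases hac : a ≤ c
  · by_cases hca : c ≤ a
    · rw [le_antisymm hac hca, mul_comm, sub_self]
    · simp [entry_eq_zero _ hca]
  · simp [entry_eq_zero _ hac]

variable (k) in
/-- The matrix unit `e_{ij}` of an edge `i < j`. -/
def matrixUnit (e : Edge P) : lieAlg k P :=
  ⟨Matrix.single e.1.1 e.1.2 1, fun _ _ hab => Matrix.single_apply_of_ne _ _ _ _ _ fun h =>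
    hab (h.1 ▸ h.2 ▸ e.2.le), Matrix.trace_single_eq_of_ne _ _ _ e.2.ne⟩

theorem entry_matrixUnit (e : Edge P) (a b : P) :
    entry a b (matrixUnit k e) = if e.1.1 = a ∧ e.1.2 = b then 1 else 0 :=
  Matrix.single_apply ..

theorem entry_matrixUnit_self (e : Edge P) :
    entry e.1.1 e.1.2 (matrixUnit k e) = 1 := by
  simp [entry_matrixUnit]

theorem entry_matrixUnit_of_ne {e e' : Edge P} (h : e' ≠ e) :
    entry e.1.1 e.1.2 (matrixUnit k e') = 0 := by
  rw [entry_matrixUnit, if_neg fun h' => h (Subtype.ext (Prod.ext h'.1 h'.2))]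

theorem entry_matrixUnit_lie (e : Edge P) (X : lieAlg k P) (a b : P) :
    entry a b ⁅matrixUnit k e, X⁆ =
      (if e.1.1 = a then entry e.1.2 b X else 0) - if e.1.2 = b then entry a e.1.1 X else 0 := by
  simp [entry_lie, entry_matrixUnit, ite_and]

theorem matrixUnit_lie_matrixUnit {e e' e'' : Edge P} (h : e.1.2 = e'.1.1)
    (h₁ : e''.1.1 = e.1.1) (h₂ : e''.1.2 = e'.1.2) :
    ⁅matrixUnit k e, matrixUnit k e'⁆ = matrixUnit k e'' := by
  have h_ne : e'.1.2 ≠ e.1.1 := (e.2.trans (h ▸ e'.2)).ne'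
  refine ext_entry fun a b => ?_
  simp [entry_matrixUnit_lie, entry_matrixUnit, h, h₁, h₂, h_ne, ite_and]

theorem matrixUnit_lie_matrixUnit_eq_zero {e e' : Edge P} (h : e.1.2 ≠ e'.1.1)
    (h' : e'.1.2 ≠ e.1.1) :
    ⁅matrixUnit k e, matrixUnit k e'⁆ = 0 := by
  refine ext_entry fun a b => ?_
  simp [entry_matrixUnit_lie, entry_matrixUnit, h.symm, h']

variable (k) in
/-- The difference `e_{pp} - e_{qq}` of diagonal matrix units. -/
def cartanGen (p q : P) : lieAlg k P :=
  ⟨Matrix.diagonal (Pi.single p 1 - Pi.single q 1),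
    fun _ _ hab => Matrix.diagonal_apply_ne _ fun h => hab h.le, by simp [Matrix.trace_diagonal]⟩

theorem entry_cartanGen (p q a b : P) :
    entry a b (cartanGen k p q) =
      if a = b then (if a = p then 1 else 0) - (if a = q then 1 else 0) else 0 := by
  change Matrix.diagonal (Pi.single p 1 - Pi.single q 1 : P → k) a b = _
  simp only [Matrix.diagonal_apply, Pi.sub_apply, Pi.single_apply]

@[simp]
theorem cartanGen_self (p : P) : cartanGen k p p = 0 :=
  ext_entry fun a b => by simp [entry_cartanGen]

theorem entry_cartanGen_lie (p q : P) (X : lieAlg k P) (a b : P) :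
    entry a b ⁅cartanGen k p q, X⁆ = (weight k p a b - weight k q a b) * entry a b X := by
  rw [entry_lie, weight, weight]
  simp only [entry_cartanGen, ite_mul, mul_ite, zero_mul, mul_zero, Finset.sum_ite_eq,
    Finset.sum_ite_eq', Finset.mem_univ, if_true]
  ring

theorem cartanGen_lie_cartanGen (p q p' q' : P) :
    ⁅cartanGen k p q, cartanGen k p' q'⁆ = 0 := by
  refine ext_entry fun a b => ?_
  rw [entry_cartanGen_lie, entry_cartanGen, map_zero]
  rcases eq_or_ne a b with rfl | h
  · rw [weight_self, weight_self, sub_self, zero_mul]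
  · rw [if_neg h, mul_zero]

theorem cartanGen_lie_matrixUnit (p q : P) (e : Edge P) :
    ⁅cartanGen k p q, matrixUnit k e⁆ =
      (weight k p e.1.1 e.1.2 - weight k q e.1.1 e.1.2) • matrixUnit k e := by
  refine ext_entry fun a b => ?_
  rw [entry_cartanGen_lie, map_smul, entry_matrixUnit, smul_eq_mul]
  split_ifs with h
  · rw [h.1, h.2]
  · simp

variable (k) in
/-- The generators of `lieAlg k P` adapted to a base point `q`: a basis of its diagonal matrices
together with all matrix units. -/
def generators (q : P) : Set (lieAlg k P) :=
  (fun p => cartanGen k p q) '' {q}ᶜ ∪ Set.range (matrixUnit k)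

theorem eq_sum_smul_cartanGen_add_sum_smul_matrixUnit [Fintype (Edge P)] (q : P) (X : lieAlg k P) :
    X = ∑ p, entry p p X • cartanGen k p q +
      ∑ e : Edge P, entry e.1.1 e.1.2 X • matrixUnit k e := by
  refine ext_entry fun a b => ?_
  simp only [map_add, map_sum, map_smul, smul_eq_mul, entry_cartanGen, entry_matrixUnit]
  rcases eq_or_ne a b with rfl | hab
  · rw [Fintype.sum_eq_zero (fun e : Edge P => _) fun e => by
      rw [if_neg fun h => (h.1.trans h.2.symm ▸ e.2).false, mul_zero]]
    simp [mul_sub, Finset.sum_sub_distrib, sum_entry_self]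
  · simp only [if_neg hab, mul_zero, Finset.sum_const_zero, zero_add]
    by_cases hlt : a < b
    · rw [Fintype.sum_eq_single ⟨(a, b), hlt⟩ fun e he => by
        rw [if_neg fun h => he (Subtype.ext (Prod.ext h.1 h.2)), mul_zero]]
      simp
    · rw [entry_eq_zero X fun h => hlt (h.lt_of_ne hab), Fintype.sum_eq_zero _ fun e => by
        rw [if_neg (by rintro ⟨rfl, rfl⟩; exact hlt e.2), mul_zero]]

theorem span_generators (q : P) : span k (generators k q) = ⊤ := by
  classical
  refine eq_top_iff.2 fun X _ => ?_
  rw [eq_sum_smul_cartanGen_add_sum_smul_matrixUnit q X]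
  refine add_mem (sum_mem fun p _ => smul_mem _ _ ?_)
    (sum_mem fun e _ => smul_mem _ _ (subset_span (Or.inr ⟨e, rfl⟩)))
  rcases eq_or_ne p q with rfl | hp
  · rw [cartanGen_self]
    exact zero_mem _
  · exact subset_span (Or.inl ⟨p, hp, rfl⟩)

theorem lieDer_cartanGen_eq_zero_of_lieDer_lieDer_eq_zero [NoZeroDivisors k] {n : ℕ} {p q : P}
    {F : lieAlg k P [⋀^Fin n]→ₗ[k] lieAlg k P}
    (hF : lieDer (cartanGen k p q) (lieDer (cartanGen k p q) F) = 0) :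
    lieDer (cartanGen k p q) F = 0 := by
  refine lieDer_eq_zero_of_lieDer_lieDer_eq_zero (span_generators q) ?_ (fun c X h => ?_) hF
  · rintro _ (⟨p', -, rfl⟩ | ⟨e, rfl⟩)
    · exact ⟨0, by rw [cartanGen_lie_cartanGen, zero_smul]⟩
    · exact ⟨_, cartanGen_lie_matrixUnit p q e⟩
  · refine ext_entry fun a b => ?_
    have hab := congrArg (entry a b) h
    simp only [entry_cartanGen_lie, map_sub, map_smul, smul_eq_mul, ← sub_eq_zero (b := c * _),
      ← sub_mul] at hab ⊢
    simpa using hab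

end PosetAlgebra

section ChainEval

variable {P : Type*} [PartialOrder P] {n : ℕ}

theorem Chain.edge_face_last (c : Chain P (n + 2)) (l : Fin n) :
    (c.face (Fin.last (n + 1))).edge l = c.edge l.castSucc := by
  refine Subtype.ext (Prod.ext ?_ ?_) <;> simp [Chain.edge, Chain.face_apply]

theorem Chain.edge_face_succAbove (c : Chain P (n + 3)) (i : Fin (n + 1)) (l : Fin n) :
    (c.face i.castSucc.succ).edge (i.succAbove l) = c.edge (i.succ.succAbove (i.succAbove l)) := by
  refine Subtype.ext (Prod.ext (congrArg c ?_) (congrArg c ?_)) <;>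
    simp only [Fin.succAbove, Fin.ext_iff] <;> grind

variable {k : Type*} [CommRing k] [Fintype P] [DecidableEq P]

theorem matrixUnit_edge_lie_matrixUnit_edge (c : Chain P (n + 3)) (i : Fin (n + 1)) :
    ⁅matrixUnit k (c.edge i.castSucc), matrixUnit k (c.edge i.succ)⁆ =
      matrixUnit k ((c.face i.castSucc.succ).edge i) := by
  refine matrixUnit_lie_matrixUnit rfl (congrArg c ?_) (congrArg c ?_) <;>
    simp [Fin.succAbove, Fin.lt_def]

theorem matrixUnit_edge_lie_matrixUnit_edge_eq_zero (c : Chain P (n + 3)) {i : Fin (n + 1)}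
    {j : Fin (n + 2)} (hij : i.castSucc < j) (hj : j ≠ i.succ) :
    ⁅matrixUnit k (c.edge i.castSucc), matrixUnit k (c.edge j)⁆ = 0 := by
  refine matrixUnit_lie_matrixUnit_eq_zero (c.strictMono ?_).ne (c.strictMono ?_).ne' <;>
    simp [Fin.lt_def, Fin.ext_iff] at * <;> lia

variable (k) in
/-- The matrix units of the edges of a simplex. -/
def matrixUnits (c : Chain P (n + 1)) : Fin n → lieAlg k P := fun l => matrixUnit k (c.edge l)

theorem ceBracketTerm_matrixUnits {M : Type*} [AddCommGroup M] [Module k M]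
    (F : lieAlg k P [⋀^Fin (n + 1)]→ₗ[k] M) (c : Chain P (n + 3)) :
    ceBracketTerm k (lieAlg k P) M F (matrixUnits k c) =
      ∑ i : Fin (n + 1), (-1 : k) ^ (i + 1 : ℕ) • F (matrixUnits k (c.face i.castSucc.succ)) := by
  rw [ceBracketTerm, Finset.sum_comm]
  refine Finset.sum_congr rfl fun i _ => ?_
  have h_rest : (fun l => matrixUnits k c (i.succ.succAbove (i.succAbove l))) =
      i.removeNth (matrixUnits k (c.face i.castSucc.succ)) :=
    funext fun l => (congrArg (matrixUnit k) (c.edge_face_succAbove i l)).symm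
  rw [Fintype.sum_eq_single i.succ, if_pos Fin.castSucc_lt_succ, h_rest, Fin.val_succ, pow_add,
    mul_smul, smul_comm, neg_one_pow_smul_map_cons_removeNth, Function.update_eq_self_iff.2]
  · exact matrixUnit_edge_lie_matrixUnit_edge c i
  · intro j hj
    split_ifs with hij
    · rw [F.map_coord_zero 0, smul_zero]
      exact matrixUnit_edge_lie_matrixUnit_edge_eq_zero c hij hj
    · rfl

/-- The simplicial cochain `c ↦ F (e₀, …, e_{n-1})_{c 0, c n}` of a cochain `F`, where the `e_l` are
the matrix units of the edges of `c`. -/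
def chainEval : (lieAlg k P [⋀^Fin n]→ₗ[k] lieAlg k P) →ₗ[k] (Chain P (n + 1) → k) where
  toFun F c := entry (c 0) (c (Fin.last n)) (F (matrixUnits k c))
  map_add' _ _ := funext fun _ => map_add _ _ _
  map_smul' _ _ := funext fun _ => map_smul _ _ _

theorem chainEval_apply (F : lieAlg k P [⋀^Fin n]→ₗ[k] lieAlg k P) (c : Chain P (n + 1)) :
    chainEval F c = entry (c 0) (c (Fin.last n)) (F (matrixUnits k c)) := rfl

theorem entry_sum_matrixUnits_lie (c : Chain P (n + 2)) (X : Fin (n + 1) → lieAlg k P) :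
    entry (c 0) (c (Fin.last (n + 1)))
        (∑ i : Fin (n + 1), (-1 : k) ^ (i : ℕ) • ⁅matrixUnits k c i, X i⁆) =
      entry (c 1) (c (Fin.last (n + 1))) (X 0) +
        (-1) ^ (n + 1) * entry (c 0) (c (Fin.last n).castSucc) (X (Fin.last n)) := by
  have h_source : ∀ i : Fin (n + 1), (c.edge i).1.1 = c 0 ↔ i = 0 := fun i =>
    c.strictMono.injective.eq_iff' rfl |>.trans (Fin.castSucc_eq_zero_iff ..)
  have h_target : ∀ i : Fin (n + 1), (c.edge i).1.2 = c (Fin.last (n + 1)) ↔ i = Fin.last n :=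
    fun i => c.strictMono.injective.eq_iff.trans (Fin.succ_eq_last_succ ..)
  simp only [map_sum, map_smul, matrixUnits, entry_matrixUnit_lie, h_source, h_target]
  simp [mul_add, Finset.sum_add_distrib, Chain.edge, pow_succ, sub_eq_add_neg]

theorem chainEval_ceD (F : lieAlg k P [⋀^Fin n]→ₗ[k] lieAlg k P) :
    chainEval (ceD F) = nerveDelta k P (n + 1) (chainEval F) := by
  funext c
  have h_action : entry (c 0) (c (Fin.last (n + 1)))
      (∑ i : Fin (n + 1), (-1 : k) ^ (i : ℕ) •
        ⁅matrixUnits k c i, F (i.removeNth (matrixUnits k c))⁆) =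
      chainEval F (c.face 0) + (-1) ^ (n + 1) * chainEval F (c.face (Fin.last (n + 1))) := by
    have h_first : (0 : Fin (n + 1)).removeNth (matrixUnits k c) = matrixUnits k (c.face 0) := rfl
    have h_last : (Fin.last n).removeNth (matrixUnits k c) =
        matrixUnits k (c.face (Fin.last (n + 1))) := funext fun l => by
      rw [Fin.removeNth_apply, Fin.succAbove_last, matrixUnits, matrixUnits, Chain.edge_face_last]
    rw [entry_sum_matrixUnits_lie, h_first, h_last]
    simp [chainEval_apply, Chain.face_apply]
  have h_bracket : entry (c 0) (c (Fin.last (n + 1)))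
      (ceBracketTerm k (lieAlg k P) (lieAlg k P) F (matrixUnits k c)) =
      ∑ i : Fin n, (-1) ^ (i + 1 : ℕ) * chainEval F (c.face i.castSucc.succ) := by
    cases n with
    | zero => simp [ceBracketTerm]
    | succ n =>
      simp [ceBracketTerm_matrixUnits, chainEval_apply, Chain.face_apply]
  rw [chainEval_apply, ceD_apply, ceDelta_apply, map_add, h_action, h_bracket, nerveDelta_apply,
    Fin.sum_univ_succ, Fin.sum_univ_castSucc]
  simp
  ring

end ChainEval

section RelativeCochains

variable {k P : Type*} [Field k] [PartialOrder P] [Fintype P] [DecidableEq P] {n : ℕ} {q : P}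

variable (k) in
/-- The adjoint cochains of `lieAlg k P` relative to its diagonal matrices, of which the
`cartanGen k p q` with `p ≠ q` form a basis. -/
abbrev cartanRelForms (q : P) (n : ℕ) : Submodule k (lieAlg k P [⋀^Fin n]→ₗ[k] lieAlg k P) :=
  relForms k (lieAlg k P) (fun p : {p // p ≠ q} => cartanGen k p.1 q) Set.univ Set.univ n

theorem weight_eq_sum_weight_of_entry_ne_zero (hN : (Fintype.card P : k) ≠ 0)
    {F : lieAlg k P [⋀^Fin n]→ₗ[k] lieAlg k P} (hF : ∀ p ≠ q, lieDer (cartanGen k p q) F = 0)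
    {x : Fin n → Edge P} {a b : P} (h : entry a b (F fun l => matrixUnit k (x l)) ≠ 0) (p : P) :
    weight k p a b = ∑ l, weight k p (x l).1.1 (x l).1.2 := by
  set defect : P → k := fun p => weight k p a b - ∑ l, weight k p (x l).1.1 (x l).1.2 with h_defect
  have h_const : ∀ p, defect p = defect q := by
    intro p
    rcases eq_or_ne p q with rfl | hp
    · rfl
    have h_zero := lieDer_apply_of_forall_lie_eq_smul
      (fun l => cartanGen_lie_matrixUnit (k := k) p q (x l)) F
    rw [hF p hp, AlternatingMap.zero_apply, eq_comm] at h_zero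
    have h_entry := congrArg (entry a b) h_zero
    rw [map_sub, map_smul, entry_cartanGen_lie, smul_eq_mul, ← sub_mul, map_zero,
      Finset.sum_sub_distrib] at h_entry
    linear_combination (mul_eq_zero.1 h_entry).resolve_right h
  have h_sum : ∑ p, defect p = 0 := by
    simp only [h_defect, Finset.sum_sub_distrib, sum_weight]
    rw [Finset.sum_comm]
    simp [sum_weight]
  rw [Fintype.sum_congr _ _ h_const, Finset.sum_const, nsmul_eq_mul, Finset.card_univ] at h_sum
  exact sub_eq_zero.1 ((h_const p).trans ((mul_eq_zero.1 h_sum).resolve_left hN))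

theorem apply_matrixUnit_eq_zero_of_chainEval_eq_zero
    (hk : ringChar k = 0 ∨ Fintype.card P < ringChar k)
    {F : lieAlg k P [⋀^Fin n]→ₗ[k] lieAlg k P} (hF : ∀ p ≠ q, lieDer (cartanGen k p q) F = 0)
    (h : chainEval F = 0) (x : Fin n → Edge P) : F (fun l => matrixUnit k (x l)) = 0 := by
  have : Nonempty P := ⟨q⟩
  by_cases hx : Function.Injective x
  · refine ext_entry fun a b => ?_
    by_contra h_ne
    obtain ⟨c, rfl, rfl, σ, hσ⟩ := exists_chain_of_flow_of_cast (a := a) (b := b) hk hx fun p => by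
      have h_weight := weight_eq_sum_weight_of_entry_ne_zero (natCast_card_ne_zero hk) hF h_ne p
      rw [sum_weight_edge, weight] at h_weight
      linear_combination -h_weight
    have h_units : matrixUnits k c = (fun l => matrixUnit k (x l)) ∘ σ :=
      funext fun l => congrArg (matrixUnit k) (hσ l).symm
    have h_eval := congrFun h c
    rw [chainEval_apply, h_units, F.map_perm, Units.smul_def, map_zsmul] at h_eval
    rcases Int.units_eq_one_or (Equiv.Perm.sign σ) with h_sign | h_sign <;>
      simp_all
  · exact F.map_eq_zero_of_not_injective _ fun h' =>
      hx (.of_comp (f := matrixUnit k) h')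

theorem disjoint_cartanRelForms_ker_chainEval
    (hk : ringChar k = 0 ∨ Fintype.card P < ringChar k) (q : P) (n : ℕ) :
    Disjoint (cartanRelForms k q n) (LinearMap.ker chainEval) := by
  refine disjoint_def.2 fun F hF h => eq_zero_of_forall_mem (span_generators q) fun g hg => ?_
  rw [mem_relForms] at hF
  by_cases h_cartan : ∃ l, ∃ p ≠ q, cartanGen k p q = g l
  · obtain ⟨l, p, hp, hl⟩ := h_cartan
    exact apply_eq_zero_of_mem_kerContr (hF.2 ⟨p, hp⟩ trivial) hl.symm
  · have h_unit : ∀ l, ∃ e, matrixUnit k e = g l := fun l =>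
      (hg l).resolve_left fun ⟨p, hp, hl⟩ => h_cartan ⟨l, p, hp, hl⟩
    choose x hx using h_unit
    rw [← funext hx]
    exact apply_matrixUnit_eq_zero_of_chainEval_eq_zero hk (fun p hp => hF.1 ⟨p, hp⟩ trivial) h x

/-- The dual cochain of a simplex `c`, with values in the span of `e_{c 0, c n}`. -/
def dualForm (c : Chain P (n + 2)) : lieAlg k P [⋀^Fin (n + 1)]→ₗ[k] lieAlg k P :=
  wedgeProd (fun l => entry (c.edge l).1.1 (c.edge l).1.2)
    (matrixUnit k ⟨(c 0, c (Fin.last _)), c.strictMono (Fin.last_pos)⟩)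

theorem chainEval_dualForm [DecidableEq (Chain P (n + 2))] (c : Chain P (n + 2)) :
    chainEval (dualForm c) = Pi.single (M := fun _ => k) c 1 := by
  funext c'
  rw [chainEval_apply]
  rcases eq_or_ne c' c with rfl | h
  · have h_inj : Function.Injective c'.edge := fun i j hij => Fin.castSucc_injective _
      (c'.strictMono.injective (congrArg (fun e : Edge P => e.1.1) hij))
    have h_self : dualForm c' (matrixUnits k c') = _ :=
      wedgeProd_apply_dual (fun i => entry_matrixUnit_self (c'.edge i))
        (fun i j hij => entry_matrixUnit_of_ne (h_inj.ne hij.symm)) _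
    rw [h_self, Pi.single_eq_same]
    exact entry_matrixUnit_self ⟨(_, _), _⟩
  · obtain ⟨l, hl⟩ := Chain.exists_edge_notMem_of_ne h
    have h_zero : dualForm c (matrixUnits k c') = 0 :=
      apply_eq_zero_of_mem_kerContr (l := l) (x := matrixUnit k (c'.edge l))
        (wedgeProd_mem_kerContr (fun i => entry_matrixUnit_of_ne (hl i).symm) _) rfl
    rw [Pi.single_eq_of_ne h, h_zero, map_zero]

theorem dualForm_mem_cartanRelForms (c : Chain P (n + 2)) :
    dualForm c ∈ cartanRelForms k q (n + 1) := by
  refine mem_relForms.2 ⟨fun p _ => ?_, fun p _ => wedgeProd_mem_kerContr (fun i => ?_) _⟩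
  · have h_eigen : ∀ i : Fin (n + 1), entry (c.edge i).1.1 (c.edge i).1.2 ∘ₗ
        LieAlgebra.ad k (lieAlg k P) (cartanGen k p.1 q) =
          (weight k p.1 (c.edge i).1.1 (c.edge i).1.2 -
            weight k q (c.edge i).1.1 (c.edge i).1.2) • entry (c.edge i).1.1 (c.edge i).1.2 :=
      fun i => LinearMap.ext fun X => entry_cartanGen_lie _ _ X _ _
    rw [dualForm, lieDer_wedgeProd h_eigen (cartanGen_lie_matrixUnit _ _ _),
      Finset.sum_sub_distrib, sum_weight_chain, sum_weight_chain, sub_self, zero_smul]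
  · rw [entry_cartanGen, if_neg (c.edge i).2.ne]

theorem map_chainEval_cartanRelForms_succ (q : P) (n : ℕ) :
    (cartanRelForms k q (n + 1)).map chainEval = ⊤ := by
  classical
  have := Fintype.ofFinite (Chain P (n + 2))
  rw [eq_top_iff, ← (Pi.basisFun k (Chain P (n + 2))).span_eq, span_le]
  rintro _ ⟨c, rfl⟩
  exact ⟨dualForm c, dualForm_mem_cartanRelForms c, by rw [chainEval_dualForm, Pi.basisFun_apply]⟩

end RelativeCochains

section Comparison

variable {k P : Type*} [Field k] [PartialOrder P] [Fintype P] [DecidableEq P] {n : ℕ} {q : P}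

theorem isCompl_map_chainEval_cartanRelForms_zero (hN : (Fintype.card P : k) ≠ 0) (q : P) :
    IsCompl ((cartanRelForms k q 0).map chainEval) (LinearMap.range (nerveDelta k P 0)) := by
  have h_eval : ∀ (F : lieAlg k P [⋀^Fin 0]→ₗ[k] lieAlg k P) p,
      chainEval F (pointChain p) = entry p p (F Fin.elim0) := fun F p =>
    congrArg (fun g => entry p p (F g)) (Subsingleton.elim _ _)
  refine ⟨disjoint_def.2 ?_, codisjoint_iff.2 (eq_top_iff.2 fun f _ => ?_)⟩
  · rintro _ ⟨F, -, rfl⟩ ⟨u, hu⟩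
    have h_sum := sum_entry_self (F Fin.elim0)
    simp only [← h_eval, ← hu, nerveDelta_zero_apply, Finset.sum_const, Finset.card_univ,
      nsmul_eq_mul] at h_sum
    funext c
    rw [← hu, nerveDelta_zero_apply, (mul_eq_zero.1 h_sum).resolve_left hN, Pi.zero_apply]
  · set mean : k := (Fintype.card P : k)⁻¹ * ∑ p, f (pointChain p) with h_mean
    set X : lieAlg k P := ∑ p, (f (pointChain p) - mean) • cartanGen k p q with hX
    have h_sum : ∑ p, (f (pointChain p) - mean) = 0 := by
      simp [h_mean, hN]
    have h_entry : ∀ p, entry p p X = f (pointChain p) - mean := fun p => by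
      simp [hX, entry_cartanGen, mul_sub, Finset.sum_sub_distrib, h_sum]
    have h_mem : AlternatingMap.constOfIsEmpty k (lieAlg k P) (Fin 0) X ∈ cartanRelForms k q 0 :=
      mem_relForms.2 ⟨fun p _ => AlternatingMap.ext fun g => by
        simp [lieDer_apply, hX, lie_sum, cartanGen_lie_cartanGen], fun _ _ => mem_top⟩
    have h_split : f = chainEval (AlternatingMap.constOfIsEmpty k (lieAlg k P) (Fin 0) X) +
        nerveDelta k P 0 fun _ => mean := by
      funext c
      rw [Pi.add_apply, nerveDelta_zero_apply, ← pointChain_apply_zero c, h_eval]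
      simp [h_entry]
    rw [h_split]
    exact add_mem_sup (mem_map_of_mem h_mem) ⟨_, rfl⟩

variable (hk : ringChar k = 0 ∨ Fintype.card P < ringChar k)
include hk

theorem finrank_cartanRelForms_inf_ker_ceD (q : P) (n : ℕ) :
    finrank k ↥(cartanRelForms k q n ⊓ LinearMap.ker ceD) =
      finrank k
        ↥((cartanRelForms k q n).map chainEval ⊓ LinearMap.ker (nerveDelta k P (n + 1))) := by
  have h_map : (cartanRelForms k q n ⊓ LinearMap.ker ceD).map chainEval =
      (cartanRelForms k q n).map chainEval ⊓ LinearMap.ker (nerveDelta k P (n + 1)) := by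
    refine le_antisymm ?_ ?_
    · rintro _ ⟨F, ⟨hF, hdF⟩, rfl⟩
      refine ⟨mem_map_of_mem hF, ?_⟩
      rw [SetLike.mem_coe, LinearMap.mem_ker, ← chainEval_ceD, show ceD F = 0 from hdF, map_zero]
    · rintro _ ⟨⟨F, hF, rfl⟩, hdF⟩
      refine ⟨F, ⟨hF, disjoint_def.1 (disjoint_cartanRelForms_ker_chainEval hk q (n + 1)) _
        (ceD_mem_relForms subset_rfl n F hF) ?_⟩, rfl⟩
      rwa [LinearMap.mem_ker, chainEval_ceD]
  rw [← h_map, finrank_map_of_disjoint_ker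
    ((disjoint_cartanRelForms_ker_chainEval hk q n).mono_left inf_le_left)]

theorem finrank_map_ceD_cartanRelForms (q : P) (n : ℕ) :
    finrank k ((cartanRelForms k q n).map ceD) =
      finrank k (LinearMap.range (nerveDelta k P (n + 1))) := by
  have : Nonempty P := ⟨q⟩
  have h_comm : ((cartanRelForms k q n).map ceD).map chainEval =
      ((cartanRelForms k q n).map chainEval).map (nerveDelta k P (n + 1)) := by
    rw [← Submodule.map_comp, ← Submodule.map_comp]
    exact congrArg (fun f => Submodule.map f _) (LinearMap.ext chainEval_ceD)
  have h_range : ((cartanRelForms k q n).map chainEval).map (nerveDelta k P (n + 1)) =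
      LinearMap.range (nerveDelta k P (n + 1)) := by
    cases n with
    | zero =>
      have h_compl := isCompl_map_chainEval_cartanRelForms_zero (natCast_card_ne_zero hk) q
      rw [LinearMap.range_eq_map, ← h_compl.sup_eq_top, Submodule.map_sup, ← LinearMap.range_comp,
        show nerveDelta k P (0 + 1) ∘ₗ nerveDelta k P 0 = 0 from
          LinearMap.ext nerveDelta_nerveDelta, LinearMap.range_zero, sup_bot_eq]
    | succ n => rw [map_chainEval_cartanRelForms_succ, LinearMap.range_eq_map]
  rw [← h_range, ← h_comm, finrank_map_of_disjoint_ker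
    ((disjoint_cartanRelForms_ker_chainEval hk q (n + 1)).mono_left
      (map_le_iff_le_comap.2 (ceD_mem_relForms subset_rfl n)))]

theorem finrank_augNerveCohomology (q : P) (n : ℕ) :
    (finrank k (augNerveCohomology k P n) : ℤ) =
      coeff n (ceCohomologySeries (cartanRelForms k q)) := by
  have : Nonempty P := ⟨q⟩
  have h_le : LinearMap.range (nerveDelta k P n) ≤ LinearMap.ker (nerveDelta k P (n + 1)) :=
    LinearMap.range_le_ker_iff.2 (LinearMap.ext nerveDelta_nerveDelta)
  rw [finrank_quotient_submoduleOf h_le]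
  cases n with
  | zero =>
    have h_compl := isCompl_map_chainEval_cartanRelForms_zero (natCast_card_ne_zero hk) q
    have h_sup : (cartanRelForms k q 0).map chainEval ⊓ LinearMap.ker (nerveDelta k P 1) ⊔
        LinearMap.range (nerveDelta k P 0) = LinearMap.ker (nerveDelta k P 1) := by
      rw [← inf_comm, inf_sup_assoc_of_le _ h_le, h_compl.sup_eq_top, inf_top_eq]
    have h_finrank := finrank_sup_add_finrank_inf_eq
      ((cartanRelForms k q 0).map chainEval ⊓ LinearMap.ker (nerveDelta k P 1))
      (LinearMap.range (nerveDelta k P 0))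
    rw [h_sup, (h_compl.disjoint.mono_left inf_le_left).eq_bot, finrank_bot] at h_finrank
    rw [coeff_zero_cohomologySeries, finrank_cartanRelForms_inf_ker_ceD hk]
    lia
  | succ n =>
    rw [coeff_succ_cohomologySeries, finrank_cartanRelForms_inf_ker_ceD hk,
      finrank_map_ceD_cartanRelForms hk, map_chainEval_cartanRelForms_succ, top_inf_eq]

omit hk in
theorem coeff_one_add_X_pow (m n : ℕ) : coeff n ((1 + X : ℤ⟦X⟧) ^ m) = m.choose n := by
  have h := Polynomial.coeff_one_add_X_pow ℤ m n
  rw [← Polynomial.coeff_coe] at h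
  simpa using h

theorem finrank_adjointCohomology [Nonempty P] (n : ℕ) :
    finrank k (adjointCohomology k P n) = ∑ x ∈ Finset.HasAntidiagonal.antidiagonal n,
      (Fintype.card P - 1).choose x.1 * finrank k (augNerveCohomology k P x.2) := by
  obtain ⟨q⟩ := ‹Nonempty P›
  have h_top := ceCohomologySeries_top (k := k) (M := lieAlg k P)
    (H := fun p : {p // p ≠ q} => cartanGen k p.1 q) (ξ := fun p => entry p.1 p.1)
    (fun p p' => cartanGen_lie_cartanGen _ _ _ _)
    (fun p n F => lieDer_cartanGen_eq_zero_of_lieDer_lieDer_eq_zero)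
    (fun p => entry_self_lie _) (fun p => by simp [entry_cartanGen, p.2])
    fun p p' h => by simp [entry_cartanGen, p.2, Subtype.coe_injective.ne h]
  have h_card : Fintype.card {p // p ≠ q} = Fintype.card P - 1 := by
    simp [Fintype.card_subtype_compl]
  have h_coeff := congrArg (coeff n) h_top
  rw [← finrank_ceCohomology, coeff_mul, h_card] at h_coeff
  simp only [coeff_one_add_X_pow, ← finrank_augNerveCohomology hk] at h_coeff
  exact_mod_cast h_coeff

end Comparison

section ExteriorPower

theorem pairingDual_bijective {R V : Type*} [CommRing R] [AddCommGroup V] [Module R V]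
    [Module.Free R V] [Module.Finite R V] (p : ℕ) :
    Function.Bijective (exteriorPower.pairingDual R V p) := by
  classical
  cases subsingleton_or_nontrivial R
  · have := Module.subsingleton R (⋀[R]^p (Module.Dual R V))
    have := Module.subsingleton R (Module.Dual R (⋀[R]^p V))
    exact ⟨Function.injective_of_subsingleton _, fun f => ⟨0, Subsingleton.elim _ _⟩⟩
  let b := Module.finBasis R V
  have h_basis : exteriorPower.pairingDual R V p =
      ((b.dualBasis.exteriorPower p).equiv (b.exteriorPower p).dualBasis
        (Equiv.refl _)).toLinearMap := by
    refine (b.dualBasis.exteriorPower p).ext fun s => ?_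
    rw [LinearEquiv.coe_coe, Basis.equiv_apply, exteriorPower.basis_apply, Basis.coe_dualBasis,
      Basis.coe_dualBasis, exteriorPower.basis_coord]
    rfl
  rw [h_basis]
  exact LinearEquiv.bijective _

/-- The exterior powers of the dual of `V` as the spaces of alternating forms on `V`, the wedge of
`ξ₁, …, ξ_p` being the form `(v₁, …, v_p) ↦ det (ξ_i (v_j))`. -/
noncomputable def exteriorPowerDualEquiv (R V : Type*) [CommRing R] [AddCommGroup V] [Module R V]
    [Module.Free R V] [Module.Finite R V] (p : ℕ) :
    ⋀[R]^p (Module.Dual R V) ≃ₗ[R] V [⋀^Fin p]→ₗ[R] R :=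
  (LinearEquiv.ofBijective _ (pairingDual_bijective p)).trans
    exteriorPower.alternatingMapLinearEquiv.symm

theorem exteriorPowerDualEquiv_ιMulti_apply {R V : Type*} [CommRing R] [AddCommGroup V] [Module R V]
    [Module.Free R V] [Module.Finite R V] {p : ℕ} (ξ : Fin p → Module.Dual R V) (v : Fin p → V) :
    exteriorPowerDualEquiv R V p (exteriorPower.ιMulti R p ξ) v =
      (Matrix.of fun i j => ξ i (v j)).det := by
  rw [← Matrix.det_transpose]
  exact exteriorPower.pairingDual_ιMulti_ιMulti ξ v

end ExteriorPower

section DegreeZero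

variable {k L M : Type*} [CommRing k] [LieRing L] [LieAlgebra k L]
  [AddCommGroup M] [Module k M] [LieRingModule L M] [LieModule k L M]

theorem constOfIsEmpty_mem_ceCocycles_iff {y : M} :
    AlternatingMap.constOfIsEmpty k L (Fin 0) y ∈ ceCocycles k L M 0 ↔
      y ∈ LieModule.maxTrivSubmodule k L M := by
  rw [LieModule.mem_maxTrivSubmodule, ceCocycles, LinearMap.mem_ker]
  constructor
  · intro h x
    simpa [ceDelta_apply, ceBracketTerm] using congrFun h fun _ => x
  · intro h
    funext g
    simpa [ceDelta_apply, ceBracketTerm] using h (g 0)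

variable (k L M) in
/-- Cohomology in degree `0` is the space of invariants; for the adjoint module, the center. -/
noncomputable def ceCohomologyZeroEquiv :
    ceCohomology k L M 0 ≃ₗ[k] LieModule.maxTrivSubmodule k L M :=
  (Submodule.quotEquivOfEqBot _ (by simp [ceCoboundaries, Submodule.submoduleOf])).trans
    (AlternatingMap.constLinearEquivOfIsEmpty.symm.ofSubmodules _ _ <|
      (Submodule.map_equiv_eq_comap_symm _ _).trans <|
        Submodule.ext fun _ => constOfIsEmpty_mem_ceCocycles_iff)

end DegreeZero

section Abelian

variable {k L M : Type*} [CommRing k] [LieRing L] [LieAlgebra k L] [IsLieAbelian L]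

section TrivialAction

variable [AddCommGroup M] [Module k M] [LieRingModule L M] [LieModule k L M]
  [LieModule.IsTrivial L M] {n : ℕ}

theorem ceDelta_eq_zero (F : L [⋀^Fin n]→ₗ[k] M) : ceDelta k L M n F = 0 := by
  funext g
  have h_bracket : ceBracketTerm k L M F g = 0 := by
    cases n with
    | zero => rfl
    | succ n =>
      refine Finset.sum_eq_zero fun j _ => Finset.sum_eq_zero fun i _ => ?_
      rw [trivial_lie_zero, F.map_coord_zero 0 (Fin.cons_zero _ _), smul_zero, ite_self]
  simp [ceDelta_apply, h_bracket, trivial_lie_zero]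

theorem ceCocycles_eq_top : ceCocycles k L M n = ⊤ :=
  LinearMap.ker_eq_top.2 (LinearMap.ext ceDelta_eq_zero)

theorem ceCoboundaries_eq_bot : ceCoboundaries k L M n = ⊥ := by
  cases n with
  | zero => rfl
  | succ n =>
    refine (Submodule.eq_bot_iff _).2 fun F ⟨G, hG⟩ => AlternatingMap.ext fun g => ?_
    rw [hG, ceDelta_eq_zero]
    rfl

variable (k L M n) in
/-- The class map, for an abelian Lie algebra acting trivially: every cochain is a cocycle and the
only coboundary is zero. -/
noncomputable def alternatingMapEquivCeCohomology :
    (L [⋀^Fin n]→ₗ[k] M) ≃ₗ[k] ceCohomology k L M n :=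
  ((LinearEquiv.ofEq _ _ ceCocycles_eq_top).trans Submodule.topEquiv).symm.trans
    (Submodule.quotEquivOfEqBot _ (by simp [ceCoboundaries_eq_bot, Submodule.submoduleOf])).symm

end TrivialAction

variable [Module.Free k L] [Module.Finite k L]

variable (k L) in
/-- The cohomology of an abelian Lie algebra with trivial coefficients as an exterior algebra. -/
noncomputable def exteriorPowerDualEquivCeCohomology (p : ℕ) :
    ⋀[k]^p (Module.Dual k L) ≃ₗ[k] ceCohomology k L (TrivialLieModule k L k) p :=
  (exteriorPowerDualEquiv k L p).trans <|
    ((TrivialLieModule.equiv k L k).symm.alternatingMapCongrRight).trans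
      (alternatingMapEquivCeCohomology k L (TrivialLieModule k L k) p)

theorem exists_exteriorPowerDualEquivCeCohomology_ιMulti_eq_mk (p : ℕ)
    (ξ : Fin p → Module.Dual k L) :
    ∃ z : ceCocycles k L (TrivialLieModule k L k) p,
      (∀ h, TrivialLieModule.equiv k L k (z.1 h) = (Matrix.of fun i j => ξ i (h j)).det) ∧
      exteriorPowerDualEquivCeCohomology k L p (exteriorPower.ιMulti k p ξ) =
        Submodule.Quotient.mk z :=
  ⟨⟨(TrivialLieModule.equiv k L k).symm.toLinearMap.compAlternatingMap
      (exteriorPowerDualEquiv k L p (exteriorPower.ιMulti k p ξ)), ceDelta_eq_zero _⟩,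
    exteriorPowerDualEquiv_ιMulti_apply ξ, rfl⟩

end Abelian

section Cartan

variable {k P : Type*} [Fintype P] [DecidableEq P]

instance [CommRing k] : IsLieAbelian (cartan k P) where
  trivial x y := by
    refine Subtype.ext ?_
    change ⁅x.1, y.1⁆ = 0
    rw [← x.2.1.diagonal_diag, ← y.2.1.diagonal_diag]
    exact (Matrix.commute_diagonal _ _).lie_eq

theorem map_diagLinearMap_cartan [CommRing k] :
    (cartan k P).toSubmodule.map (Matrix.diagLinearMap P k k) =
      LinearMap.ker (∑ i, LinearMap.proj i : (P → k) →ₗ[k] k) := by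
  ext t
  constructor
  · rintro ⟨x, hx, rfl⟩
    simpa [Matrix.trace] using hx.2
  · intro ht
    exact ⟨Matrix.diagonal t, ⟨Matrix.isDiag_diagonal t, by simpa [Matrix.trace] using ht⟩,
      Matrix.diag_diagonal t⟩

variable [Field k] [Nonempty P]

theorem finrank_cartan : finrank k (cartan k P) = Fintype.card P - 1 := by
  have h_disjoint : Disjoint (cartan k P).toSubmodule
      (LinearMap.ker (Matrix.diagLinearMap P k k)) :=
    Submodule.disjoint_def.2 fun x hx h => hx.1.diagonal_diag.symm.trans <|
      (congrArg Matrix.diagonal h).trans Matrix.diagonal_zero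
  have h_sum : (∑ i, LinearMap.proj i : Module.Dual k (P → k)) ≠ 0 := fun h => by
    classical
    simpa using LinearMap.congr_fun h (Pi.single (Classical.arbitrary P) 1)
  have h_ker := Module.Dual.finrank_ker_add_one_of_ne_zero h_sum
  rw [← map_diagLinearMap_cartan, finrank_map_of_disjoint_ker h_disjoint,
    finrank_fintype_fun_eq_card] at h_ker
  exact Nat.eq_sub_of_add_eq h_ker

theorem finrank_cartanDualPower (p : ℕ) :
    finrank k (cartanDualPower k P p) = (Fintype.card P - 1).choose p := by
  rw [exteriorPower.finrank_eq, Subspace.dual_finrank_eq, finrank_cartan]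

end Cartan

section AdjointCohomology

theorem nonempty_linearEquiv_tensorProduct_prod {k U V W V' W' U' : Type*} [Field k]
    [AddCommGroup U] [Module k U] [FiniteDimensional k U]
    [AddCommGroup V] [Module k V] [FiniteDimensional k V]
    [AddCommGroup W] [Module k W] [FiniteDimensional k W]
    [AddCommGroup V'] [Module k V'] [FiniteDimensional k V']
    [AddCommGroup W'] [Module k W'] [FiniteDimensional k W']
    [AddCommGroup U'] [Module k U'] [FiniteDimensional k U']
    (h : finrank k U = finrank k V * finrank k W + (finrank k V' * finrank k W' + finrank k U')) :
    Nonempty (U ≃ₗ[k] (V ⊗[k] W) × (V' ⊗[k] W') × U') := by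
  refine FiniteDimensional.nonempty_linearEquiv_of_finrank_eq ?_
  rw [h, finrank_prod, finrank_prod, finrank_tensorProduct, finrank_tensorProduct]

theorem subsingleton_augNerveCohomologyNegOne {k P : Type*} [CommRing k] [PartialOrder P]
    [Nonempty P] : Subsingleton (augNerveCohomologyNegOne k P) :=
  Submodule.subsingleton_iff_eq_bot.2 (LinearMap.ker_eq_bot.2 nerveDelta_zero_injective)

variable {k P : Type*} [Field k] [PartialOrder P] [Fintype P] [DecidableEq P] [Nonempty P]

theorem nonempty_adjointCohomology_equiv_directSum
    (hk : ringChar k = 0 ∨ Fintype.card P < ringChar k) (A : ℕ → Type*)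
    [∀ p, AddCommGroup (A p)] [∀ p, Module k (A p)]
    (e : ∀ p, cartanDualPower k P p ≃ₗ[k] A p) (n : ℕ) :
    Nonempty (adjointCohomology k P n ≃ₗ[k]
      ⨁ x : {x : ℕ × ℕ // x.1 + x.2 = n}, A x.1.1 ⊗[k] augNerveCohomology k P x.1.2) := by
  have (p : ℕ) : Module.Finite k (A p) := Module.Finite.equiv (e p)
  have h_mem (x : ℕ × ℕ) : x ∈ Finset.HasAntidiagonal.antidiagonal n ↔ x.1 + x.2 = n :=
    Finset.HasAntidiagonal.mem_antidiagonal
  let : Fintype {x : ℕ × ℕ // x.1 + x.2 = n} := Fintype.subtype _ h_mem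
  refine FiniteDimensional.nonempty_linearEquiv_of_finrank_eq ?_
  rw [finrank_directSum, finrank_adjointCohomology hk, Finset.sum_subtype _ h_mem]
  refine Finset.sum_congr rfl fun x _ => ?_
  rw [finrank_tensorProduct, ← (e x.1.1).finrank_eq, finrank_cartanDualPower]

theorem finrank_center_lieAlg (hk : ringChar k = 0 ∨ Fintype.card P < ringChar k) :
    finrank k (LieAlgebra.center k (lieAlg k P)) = finrank k (augNerveCohomology k P 0) := by
  rw [← (ceCohomologyZeroEquiv k (lieAlg k P) (lieAlg k P)).finrank_eq,
    finrank_adjointCohomology hk]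
  simp

theorem nonempty_adjointCohomology_two_equiv
    (hk : ringChar k = 0 ∨ Fintype.card P < ringChar k) :
    Nonempty (adjointCohomology k P 2 ≃ₗ[k]
      (cartanDualPower k P 2 ⊗[k] LieAlgebra.center k (lieAlg k P)) ×
      (Module.Dual k (cartan k P) ⊗[k] nerveCohomology k P 1) × nerveCohomology k P 2) := by
  have h_pos (q : ℕ) : finrank k (nerveCohomology k P (q + 1)) =
      finrank k (augNerveCohomology k P (q + 1)) := rfl
  refine nonempty_linearEquiv_tensorProduct_prod ?_
  rw [finrank_adjointCohomology hk, finrank_cartanDualPower, Subspace.dual_finrank_eq,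
    finrank_cartan, finrank_center_lieAlg hk, h_pos, h_pos,
    Finset.Nat.sum_antidiagonal_eq_sum_range_succ_mk]
  simp [Finset.sum_range_succ_comm]

end AdjointCohomology

end LiePoset

theorem theorem10 {k : Type*} [Field k] {P : Type*} [PartialOrder P] [Fintype P] [DecidableEq P]
    [Nonempty P] (hk : ringChar k = 0 ∨ Fintype.card P < ringChar k) :
    -- `H^*(𝔤, 𝔤) ≅ ⋀ 𝔥^∨ ⊗ H^*(Σ⁺, k)` as graded vector spaces
    (∀ n : ℕ, Nonempty (LiePoset.adjointCohomology k P n ≃ₗ[k]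
      ⨁ x : {x : ℕ × ℕ // x.1 + x.2 = n},
        LiePoset.cartanDualPower k P x.1.1 ⊗[k] LiePoset.augNerveCohomology k P x.1.2)) ∧
    -- there is no contribution from degree `-1`
    Subsingleton (LiePoset.augNerveCohomologyNegOne k P) ∧
    -- the identification `⋀ 𝔥^∨ = H^*(𝔥, k)`: the element `ξ₁ ∧ ⋯ ∧ ξ_p` is the class of the
    -- alternating form `(h₁, …, h_p) ↦ det (ξ_i (h_j))`
    (∃ e : ∀ p : ℕ, LiePoset.cartanDualPower k P p ≃ₗ[k] LiePoset.cartanCohomology k P p,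
      ∀ (p : ℕ) (ξ : Fin p → Module.Dual k (LiePoset.cartan k P)),
        ∃ z : LiePoset.ceCocycles k (LiePoset.cartan k P)
            (TrivialLieModule k (LiePoset.cartan k P) k) p,
          (∀ h : Fin p → LiePoset.cartan k P,
            TrivialLieModule.equiv k (LiePoset.cartan k P) k (z.1 h) =
              (Matrix.of fun i j => ξ i (h j)).det) ∧
          e p (exteriorPower.ιMulti k p ξ) = Submodule.Quotient.mk z) ∧
    -- `H^*(𝔤, 𝔤) ≅ H^*(𝔥, k) ⊗ H^*(Σ⁺, k)` as graded vector spaces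
    (∀ n : ℕ, Nonempty (LiePoset.adjointCohomology k P n ≃ₗ[k]
      ⨁ x : {x : ℕ × ℕ // x.1 + x.2 = n},
        LiePoset.cartanCohomology k P x.1.1 ⊗[k] LiePoset.augNerveCohomology k P x.1.2)) ∧
    -- `H²(𝔤, 𝔤) ≅ (⋀² 𝔥^∨ ⊗ 𝔠) ⊕ (𝔥^∨ ⊗ H¹(Σ, k)) ⊕ H²(Σ, k)`, with `𝔠` the center of `𝔤`
    Nonempty (LiePoset.adjointCohomology k P 2 ≃ₗ[k]
      (LiePoset.cartanDualPower k P 2 ⊗[k] LieAlgebra.center k (LiePoset.lieAlg k P)) ×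
      (Module.Dual k (LiePoset.cartan k P) ⊗[k] LiePoset.nerveCohomology k P 1) ×
      LiePoset.nerveCohomology k P 2) := by
  refine ⟨fun n => ?_, LiePoset.subsingleton_augNerveCohomologyNegOne,
    ⟨LiePoset.exteriorPowerDualEquivCeCohomology k (LiePoset.cartan k P),
      LiePoset.exists_exteriorPowerDualEquivCeCohomology_ιMulti_eq_mk⟩, fun n => ?_,
    LiePoset.nonempty_adjointCohomology_two_equiv hk⟩
  · exact LiePoset.nonempty_adjointCohomology_equiv_directSum hk (LiePoset.cartanDualPower k P)
      (fun _ => .refl k _) n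
  · exact LiePoset.nonempty_adjointCohomology_equiv_directSum hk (LiePoset.cartanCohomology k P)
      (LiePoset.exteriorPowerDualEquivCeCohomology k (LiePoset.cartan k P)) n
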